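/- Let $D\subseteq\mathbf C$ be a bounded Jordan domain, fix $z\in D$ and $\beta,\delta\in(0,1)$, and let $X\subseteq\partial D$ be closed. Let $\varphi:\mathbf D\to D$ be the conformal map from the open unit disk onto $D$ with $\varphi(0)=z$ and $\varphi'(0)>0$; since $D$ is a Jordan domain, $\varphi$ extends to a homeomorphism $\overline{\mathbf D}\to\overline D$, and $\varphi^{-1}(X)\subseteq\partial\mathbf D$ denotes the preimage of $X$ under this extension. Suppose that $\varphi$ is Hölder continuous with exponent $\beta$ on $W=\{w\in\mathbf D:\operatorname{dist}(w,\varphi^{-1}(X))<\delta\}$. For $w\in\partial D$ let $\gamma^D_{z,w}:[0,\infty)\to D$ be the unit-speed hyperbolic geodesic in $D$ from $z$ to $w$, where the hyperbolic metric of $D$ is the image under a conformal map $\mathbf D\to D$ of the metric on $\mathbf D$ given by $\operatorname{dist}_{\mathrm{hyp}}^{\mathbf D}(z_1,z_2)=\inf_\gamma\int_\gamma\frac{|d\zeta|}{1-|\zeta|^2}$ (infimum over curves in $\mathbf D$ from $z_1$ to $z_2$). A Whitney square decomposition of $D$ is a family $\mathcal W$ of closed axis-parallel squares $Q$, with side lengths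 $\operatorname{len}(Q)\in\{2^n:n\in\mathbf Z\}$ and pairwise disjoint interiors, whose union is $D$ and such that $\operatorname{diam}(Q)\le\operatorname{dist}(Q,\partial D)\le 4\operatorname{diam}(Q)$ for all $Q\in\mathcal W$. For such a family and $j\in\mathbf Z$ let $$\mathcal W_j=\{Q\in\mathcal W:\operatorname{len}(Q)=2^{-j},\ \gamma^D_{z,w}([0,\infty))\cap Q\neq\emptyset\text{ for some }w\in X\}.$$ Then for every $a>0$ there is a constant $c=c(a,\beta,\delta,X,D,z)>0$ such that for every $d\in(0,2)$ for which the upper Minkowski dimension of $X$ is at most $d$, every Whitney square decomposition $\mathcal W$ of $D$ and every $j\in\mathbf Z$, the set $\mathcal W_j$ is finite and $$|\mathcal W_j|\le c\,2^{(d+a)j}.$$ -/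

import Mathlib

open Set Filter Topology Metric
open scoped NNReal ENNReal

noncomputable section

namespace WhitneyHyp

/-- The open unit disk in the complex plane. -/
def unitDisk : Set ℂ := ball (0 : ℂ) 1

/-- A bounded Jordan domain: a bounded domain (open and connected) whose boundary is a Jordan curve,
i.e. the image of the unit circle under a continuous injective map. -/
structure IsBoundedJordanDomain (D : Set ℂ) : Prop where
  isOpen : IsOpen D
  isConnected : IsConnected D
  isBounded : Bornology.IsBounded D
  boundary : ∃ Γ : Circle → ℂ, Continuous Γ ∧ Function.Injective Γ ∧ range Γ = frontier D

/-- `φ` restricted to the unit disk is a conformal map (holomorphic bijection) onto `D`. -/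
structure IsConformalOnto (φ : ℂ → ℂ) (D : Set ℂ) : Prop where
  differentiableOn : DifferentiableOn ℂ φ unitDisk
  bijOn : BijOn φ unitDisk D

/-- The hyperbolic length `∫ |dz| / (1 - |z|²)` of a curve `γ : [0,1] → 𝔻`. -/
def diskHypLength (γ : ℝ → ℂ) : ℝ :=
  ∫ t in (0 : ℝ)..1, ‖derivWithin γ (Icc 0 1) t‖ / (1 - ‖γ t‖ ^ 2)

/-- The hyperbolic distance in the unit disk: the infimum of the hyperbolic lengths of the
`C¹` curves in the disk that join the two points. -/
def diskHypDist (u v : ℂ) : ℝ :=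
  sInf {L : ℝ | ∃ γ : ℝ → ℂ, ContDiffOn ℝ 1 γ (Icc 0 1) ∧ MapsTo γ (Icc 0 1) unitDisk ∧
    γ 0 = u ∧ γ 1 = v ∧ L = diskHypLength γ}

/-- The hyperbolic distance in a simply connected domain `D`, transported from the disk by a
conformal map `ψ : 𝔻 → D`. The value does not depend on `ψ` (conformal automorphisms of the disk are
hyperbolic isometries), so for `a, b ∈ D` the set below has exactly one element. -/
def hypDist (D : Set ℂ) (a b : ℂ) : ℝ :=
  sInf {r : ℝ | ∃ ψ : ℂ → ℂ, IsConformalOnto ψ D ∧ ∃ u ∈ unitDisk, ∃ v ∈ unitDisk,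
    ψ u = a ∧ ψ v = b ∧ r = diskHypDist u v}

/-- `γ : [0,∞) → D` is the unit speed hyperbolic geodesic in `D` from the interior point `z` to the
boundary point `w`: it realizes the hyperbolic distance between any two of its points, it starts at
`z` and it converges to `w`. -/
structure IsHypGeodesic (D : Set ℂ) (z w : ℂ) (γ : ℝ≥0 → ℂ) : Prop where
  mem : ∀ t, γ t ∈ D
  start : γ 0 = z
  unit_speed : ∀ s t : ℝ≥0, hypDist D (γ s) (γ t) = dist s t
  tendsto : Tendsto γ atTop (𝓝 w)

/-- A closed square with sides parallel to the coordinate axes, given by its centre and its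
side length. -/
@[ext]
structure Square where
  cen : ℂ
  len : ℝ
  len_pos : 0 < len

/-- The set of points of a square. -/
def Square.carrier (Q : Square) : Set ℂ :=
  {p : ℂ | |p.re - Q.cen.re| ≤ Q.len / 2 ∧ |p.im - Q.cen.im| ≤ Q.len / 2}

/-- A Whitney square decomposition of `D`: a family of closed squares of dyadic side lengths with
pairwise disjoint interiors and union `D`, such that
`diam Q ≤ dist (Q, ∂D) ≤ 4 diam Q` for every square `Q` of the family. -/
structure IsWhitneyDecomposition (D : Set ℂ) (𝒲 : Set Square) : Prop where
  dyadic : ∀ Q ∈ 𝒲, ∃ n : ℤ, Q.len = (2 : ℝ) ^ (-n)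
  iUnion_eq : ⋃ Q ∈ 𝒲, Q.carrier = D
  disjoint : 𝒲.Pairwise fun Q R => Disjoint (interior Q.carrier) (interior R.carrier)
  diam_le : ∀ Q ∈ 𝒲, ∀ p ∈ Q.carrier, diam Q.carrier ≤ infDist p (frontier D)
  le_diam : ∀ Q ∈ 𝒲, ∃ p ∈ Q.carrier, infDist p (frontier D) ≤ 4 * diam Q.carrier

/-- The upper Minkowski dimension `limsup_{ε → 0} log N(ε) / log (1/ε)`, where `N(ε)` is the least
number of closed balls of radius `ε` with centres in `X` that cover `X`
(with value `-∞` for the empty set). -/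
def upperMinkowskiDim (X : Set ℂ) : EReal :=
  limsup (fun ε : ℝ≥0 => ENNReal.log ((coveringNumber ε X : ℕ∞) : ℝ≥0∞) /
    ((Real.log (1 / (ε : ℝ)) : ℝ) : EReal)) (𝓝[>] 0)

/-- The preimage of a set `X ⊆ ∂D` under the boundary values of a conformal map `φ : 𝔻 → D`: the
points `ζ` of the unit circle at which the radial limit of `φ` exists and lies in `X`. If `D` is a
Jordan domain, `φ` extends to a homeomorphism of the closures and this is the preimage of `X` under
the extension. -/
def boundaryPreimage (φ : ℂ → ℂ) (X : Set ℂ) : Set ℂ :=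
  {ζ ∈ sphere (0 : ℂ) 1 | ∃ x ∈ X, Tendsto (fun r : ℝ => φ (r * ζ)) (𝓝[<] 1) (𝓝 x)}

/-- The part of the unit disk at distance less than `δ` from `φ⁻¹(X)` (empty if `φ⁻¹(X)` is). -/
def boundaryNhd (φ : ℂ → ℂ) (X : Set ℂ) (δ : ℝ) : Set ℂ :=
  unitDisk ∩ thickening δ (boundaryPreimage φ X)

/-- The squares of side length `2^{-j}` of `𝒲` that are hit by the hyperbolic geodesic in `D` from
`z` to some point of `X`. -/
def hitSquares (D : Set ℂ) (z : ℂ) (X : Set ℂ) (𝒲 : Set Square) (j : ℤ) : Set Square :=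
  {Q ∈ 𝒲 | Q.len = (2 : ℝ) ^ (-j) ∧
    ∃ w ∈ X, ∃ γ : ℝ≥0 → ℂ, IsHypGeodesic D z w γ ∧ (range γ ∩ Q.carrier).Nonempty}

end WhitneyHyp

end

/-! Geodesics from `z = φ 0` are the images of radii. So a square of side `s = 2^(-j)` met by a
geodesic to `w ∈ X` contains a point `φ (r ζ)` with `|ζ| = 1`, where `φ` has radial limit `w` at
`ζ`. The geodesic itself supplies this limit, so Carathéodory's theorem plays no role.

Let `1 - r` be comparable to `2^(-n)`. The image point is at distance about `s` from the boundary,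
and the Hölder condition along the radius bounds this distance by `C 2^(-nβ)`; hence `n ≤ K` with `K
= O(j)`. Cover `X` by `N` disks of radius `s` and sort the squares by the height `n` and by the
centre `x` of a disk containing `w`. It remains to see that each class has `O(K^2)` members.

Beyond height `n`, the image of the radius starts at distance at least `c s` from `w` and is within
`c s / 2` of `w` after at most `K` dyadic steps. By Koebe each step is at most a constant times the
distance to the boundary, so at some step near `w` this distance is at least of order `s / K`.
Around that point put a disk of radius `ρ` of order `s / K`. Its preimage stays within `2 * 2^(-n)`
of `ζ`, so for radii with ends `5 * 2^(-n)` apart the disks are disjoint. They all lie in the disk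
of radius `3 s` about `x`, and area allows `O(K^2)` of them. Radii with closer ends hit their
squares at bounded hyperbolic distance, which leaves `O(1)` squares per separated radius
(`card_le_of_common_height`).

Altogether there are `O(j^3) N` squares (`exists_card_le_cover`); `a` absorbs the cubic factor and
the loss in `N ≤ 2^((d+ε)j)`. Generations below a threshold are handled by total area. The constant
is made independent of `d` by working with one admissible exponent close to the infimum. -/

noncomputable section

namespace WhitneyHyp

open ComplexConjugate

/-! ### Inverses and square roots of holomorphic functions -/

/-- An injective holomorphic function on an open set is open at every point. -/
theorem nhds_le_map_of_injOn {f : ℂ → ℂ} {U : Set ℂ} (hU : IsOpen U)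
    (hf : DifferentiableOn ℂ f U) (hinj : InjOn f U) {z : ℂ} (hz : z ∈ U) :
    𝓝 (f z) ≤ map f (𝓝 z) := by
  have han : AnalyticAt ℂ f z := hf.analyticAt (hU.mem_nhds hz)
  refine han.eventually_constant_or_nhds_le_map_nhds.resolve_left fun h => ?_
  have h1 : ∀ᶠ y in 𝓝[≠] z, f y = f z ∧ y ∈ U :=
    (h.and (hU.mem_nhds hz)).filter_mono nhdsWithin_le_nhds
  obtain ⟨y, ⟨hy, hyU⟩, hne⟩ := (h1.and self_mem_nhdsWithin).exists
  exact hne (hinj hyU hz hy)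

theorem isOpen_image_of_injOn {f : ℂ → ℂ} {U : Set ℂ} (hU : IsOpen U)
    (hf : DifferentiableOn ℂ f U) (hinj : InjOn f U) : IsOpen (f '' U) := by
  rw [isOpen_iff_mem_nhds]
  rintro _ ⟨z, hz, rfl⟩
  exact nhds_le_map_of_injOn hU hf hinj hz (image_mem_map (hU.mem_nhds hz))

/-- The inverse of an injective holomorphic function is holomorphic. -/
theorem differentiableOn_of_leftInvOn {f g : ℂ → ℂ} {U : Set ℂ} (hU : IsOpen U)
    (hf : DifferentiableOn ℂ f U) (hinj : InjOn f U) (hg : LeftInvOn g f U) :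
    DifferentiableOn ℂ g (f '' U) := by
  have hcont : ∀ z ∈ U, ContinuousAt g (f z) := by
    intro z hz
    rw [ContinuousAt, hg hz]
    refine (Filter.map_mono (nhds_le_map_of_injOn hU hf hinj hz)).trans ?_
    rw [Filter.map_map]
    have : (g ∘ f) =ᶠ[𝓝 z] id := by
      filter_upwards [hU.mem_nhds hz] with y hy using hg hy
    rw [Filter.map_congr this, Filter.map_id]
  have hright : ∀ z ∈ U, ∀ᶠ y in 𝓝 (f z), f (g y) = y := by
    intro z hz
    filter_upwards [(isOpen_image_of_injOn hU hf hinj).mem_nhds (mem_image_of_mem f hz)]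
    rintro _ ⟨x, hx, rfl⟩
    rw [hg hx]
  have hreg : ∀ z ∈ U, deriv f z ≠ 0 → DifferentiableAt ℂ g (f z) := by
    intro z hz hd
    have h1 : HasDerivAt f (deriv f z) (g (f z)) := by
      rw [hg hz]; exact (hf.differentiableAt (hU.mem_nhds hz)).hasDerivAt
    exact (HasDerivAt.of_local_left_inverse (hcont z hz) h1 hd (hright z hz)).differentiableAt
  rintro _ ⟨z, hz, rfl⟩
  refine DifferentiableAt.differentiableWithinAt ?_
  have han : AnalyticAt ℂ (deriv f) z := (hf.analyticAt (hU.mem_nhds hz)).deriv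
  -- If `deriv f` vanished near `z`, then `f` would be locally constant, against injectivity.
  -- Otherwise a zero at `z` is isolated, `g` is differentiable on a punctured neighbourhood of `f
  -- z`, and continuity removes the singularity.
  rcases han.eventually_eq_zero_or_eventually_ne_zero with h0 | h0
  · exfalso
    obtain ⟨ε, hε, hb⟩ := Metric.eventually_nhds_iff_ball.1 (h0.and (hU.mem_nhds hz))
    have hw : z + (ε / 2 : ℝ) ∈ ball z ε := by
      simp only [mem_ball, dist_eq_norm, add_sub_cancel_left, Complex.norm_real, Real.norm_eq_abs]
      rw [abs_of_pos (by positivity)]; linarith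
    have hc : f (z + (ε / 2 : ℝ)) = f z := by
      refine (convex_ball z ε).is_const_of_fderivWithin_eq_zero (𝕜 := ℂ)
        (hf.mono fun y hy => (hb y hy).2) ?_ hw (mem_ball_self hε)
      intro y hy
      rw [fderivWithin_of_isOpen isOpen_ball hy]
      ext
      simpa using (hb y hy).1
    have := hinj (hb _ hw).2 hz hc
    have h2 : ((ε / 2 : ℝ) : ℂ) = 0 := by simpa using this
    rw [Complex.ofReal_eq_zero] at h2
    linarith
  · refine (Complex.analyticAt_of_differentiable_on_punctured_nhds_of_continuousAt ?_
      (hcont z hz)).differentiableAt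
    have h1 : Tendsto g (𝓝[≠] (f z)) (𝓝[≠] z) := by
      refine tendsto_nhdsWithin_iff.2 ⟨?_, ?_⟩
      · have := (hcont z hz).tendsto
        rw [hg hz] at this
        exact this.mono_left nhdsWithin_le_nhds
      · have h2 := (hright z hz).filter_mono (nhdsWithin_le_nhds (s := {f z}ᶜ))
        filter_upwards [h2, self_mem_nhdsWithin] with y hy hne hgy
        exact hne (by rw [← hy, hgy]; rfl)
    have h2 : ∀ᶠ x in 𝓝[≠] z, x ∈ U := nhdsWithin_le_nhds (hU.mem_nhds hz)
    filter_upwards [h1.eventually h0, h1.eventually h2,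
      (hright z hz).filter_mono (nhdsWithin_le_nhds (s := {f z}ᶜ))] with y hy1 hy2 hy3
    rw [← hy3]
    exact hreg _ hy2 hy1

/-- A holomorphic square root of a zero-free holomorphic function on the unit disk. -/
theorem exists_sqrt_on_ball {f : ℂ → ℂ} (hf : DifferentiableOn ℂ f (ball 0 1))
    (h0 : ∀ u ∈ ball (0 : ℂ) 1, f u ≠ 0) :
    ∃ g : ℂ → ℂ, DifferentiableOn ℂ g (ball 0 1) ∧ ∀ u, g u ^ 2 = f u := by
  have hsc : IsSimplyConnected (ball (0 : ℂ) 1) := by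
    have : ContractibleSpace (ball (0 : ℂ) 1) :=
      (convex_ball (0 : ℂ) 1).contractibleSpace ⟨0, by simp⟩
    exact (inferInstance : SimplyConnectedSpace (ball (0 : ℂ) 1))
  obtain ⟨g, hgc, hg⟩ := Complex.exists_continuousOn_pow_eq hsc isOpen_ball hf.continuousOn
    (by rintro ⟨u, hu, h⟩; exact h0 u hu h) two_ne_zero
  refine ⟨g, fun u hu => ?_, hg⟩
  refine DifferentiableAt.differentiableWithinAt ?_
  have hgu : g u ≠ 0 := fun h => h0 u hu (by rw [← hg, h]; simp)
  have hnh := isOpen_ball.mem_nhds hu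
  have hc : ContinuousAt g u := hgc.continuousAt hnh
  have hd : HasDerivAt f (deriv f u) u := (hf.differentiableAt hnh).hasDerivAt
  refine HasDerivAt.differentiableAt (f' := deriv f u * (g u + g u)⁻¹) ?_
  rw [hasDerivAt_iff_tendsto_slope] at hd ⊢
  have h2 : g u + g u ≠ 0 := by rw [← two_mul]; exact mul_ne_zero two_ne_zero hgu
  have hs : Tendsto (fun v => g v + g u) (𝓝[≠] u) (𝓝 (g u + g u)) :=
    (hc.tendsto.add_const _).mono_left nhdsWithin_le_nhds
  refine (hd.mul (hs.inv₀ h2)).congr' ?_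
  filter_upwards [hs.eventually_ne h2] with v hv
  rw [slope_def_field, slope_def_field, ← hg, ← hg, ← div_eq_mul_inv,
    div_eq_iff hv]
  ring

/-! ### Koebe's theorem by a square root -/

/-- A weak form of the Koebe one-quarter theorem. -/
theorem norm_deriv_zero_le_of_injOn {f : ℂ → ℂ} (hf : DifferentiableOn ℂ f (ball 0 1))
    (hinj : InjOn f (ball 0 1)) (hne : (f '' ball 0 1)ᶜ.Nonempty) :
    ‖deriv f 0‖ ≤ 48 * infDist (f 0) (f '' ball 0 1)ᶜ := by
  set d := infDist (f 0) (f '' ball 0 1)ᶜ with hd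
  have h0B : (0 : ℂ) ∈ ball (0 : ℂ) 1 := by simp
  obtain ⟨w₀, hw₀, hw₀d⟩ :=
    (isOpen_image_of_injOn isOpen_ball hf hinj).isClosed_compl.exists_infDist_eq_dist hne (f 0)
  have hne0 : ∀ u ∈ ball (0 : ℂ) 1, f u - w₀ ≠ 0 := fun u hu h =>
    hw₀ ⟨u, hu, sub_eq_zero.1 h⟩
  -- `w₀` is a nearest omitted value and `g ^ 2 = f - w₀`, so `‖g 0‖ ^ 2 = d`. Injectivity of `f`
  -- makes the images of `g` and `-g` disjoint.
  obtain ⟨g, hg, hgsq⟩ := exists_sqrt_on_ball (hf.sub_const w₀) hne0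
  have hg0 : ∀ u ∈ ball (0 : ℂ) 1, g u ≠ 0 := fun u hu h => hne0 u hu (by rw [← hgsq, h]; simp)
  have hsum : ∀ u ∈ ball (0 : ℂ) 1, ∀ v ∈ ball (0 : ℂ) 1, g u ≠ -g v := by
    intro u hu v hv h
    have h1 : f u - w₀ = f v - w₀ := by rw [← hgsq, ← hgsq, h]; ring
    have h2 : u = v := hinj hu hv (sub_left_injective h1)
    subst h2
    exact hg0 u hu (self_eq_neg.1 h)
  have hginj : InjOn g (ball 0 1) := by
    intro u hu v hv h
    exact hinj hu hv (sub_left_injective (by rw [← hgsq, ← hgsq, h] : f u - w₀ = f v - w₀))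
  have hgo : IsOpen (g '' ball 0 1) := isOpen_image_of_injOn isOpen_ball hg hginj
  have h0n : (0 : ℂ) ∈ (g '' ball 0 1)ᶜ := by
    rintro ⟨u, hu, h⟩; exact hg0 u hu h
  set e := infDist (g 0) (g '' ball 0 1)ᶜ with he
  have hdn : d = ‖g 0‖ ^ 2 := by
    rw [← norm_pow, hgsq, ← dist_eq_norm]
    exact hw₀d
  have hg0p : 0 < ‖g 0‖ := norm_pos_iff.2 (hg0 0 h0B)
  obtain ⟨w₁, hw₁, hw₁e⟩ := hgo.isClosed_compl.exists_infDist_eq_dist ⟨0, h0n⟩ (g 0)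
  have hep : 0 < e := (hgo.isClosed_compl.notMem_iff_infDist_pos ⟨0, h0n⟩).1
    (fun h => h (mem_image_of_mem g h0B))
  have heg : e ≤ ‖g 0‖ := by
    simpa using infDist_le_dist_of_mem (x := g 0) h0n
  have hball : ball (g 0) e ⊆ g '' ball 0 1 := by
    intro y hy
    by_contra hy'
    have := infDist_le_dist_of_mem (x := g 0) (s := (g '' ball 0 1)ᶜ) hy'
    rw [mem_ball, dist_comm] at hy
    exact absurd hy (not_lt.2 this)
  have hw₁cl : w₁ ∈ closure (g '' ball 0 1) := by
    refine closure_mono hball ?_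
    rw [closure_ball _ hep.ne', mem_closedBall, dist_comm, ← hw₁e]
  have hw₁neg : ∀ u ∈ ball (0 : ℂ) 1, w₁ ≠ -g u := by
    intro u hu h
    have hop : IsOpen (-(g '' ball 0 1)) := hgo.neg
    obtain ⟨y, hy1, hy2⟩ := mem_closure_iff.1 hw₁cl _ hop
      (by rw [h]; simpa using mem_image_of_mem g hu)
    obtain ⟨v, hv, rfl⟩ := hy2
    obtain ⟨v', hv', h'⟩ := hy1
    exact hsum v' hv' v hv h'
  -- A nearest value `w₁` omitted by `g` is omitted by `-g` too, so `w₁ ^ 2 + w₀` is omitted by `f`.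
  -- This bounds the inradius `e` of the image of `g` from below by `‖g 0‖ / 3`.
  have hdle : d ≤ e * (3 * ‖g 0‖) := by
    have hmem : w₁ ^ 2 + w₀ ∈ (f '' ball 0 1)ᶜ := by
      rintro ⟨u, hu, h⟩
      have h1 : g u ^ 2 = w₁ ^ 2 := by rw [hgsq, h]; ring
      rcases sq_eq_sq_iff_eq_or_eq_neg.1 h1 with h2 | h2
      · exact hw₁ ⟨u, hu, h2⟩
      · exact hw₁neg u hu (by rw [h2]; ring)
    have h1 := infDist_le_dist_of_mem (x := f 0) hmem
    have h2 : f 0 - (w₁ ^ 2 + w₀) = (g 0 - w₁) * (g 0 + w₁) := by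
      linear_combination -hgsq 0
    rw [dist_eq_norm, h2, norm_mul, ← dist_eq_norm, ← hw₁e] at h1
    refine h1.trans (mul_le_mul_of_nonneg_left ?_ hep.le)
    have h3 : g 0 + w₁ = 2 * g 0 - (g 0 - w₁) := by ring
    calc ‖g 0 + w₁‖ ≤ ‖2 * g 0‖ + ‖g 0 - w₁‖ := by rw [h3]; exact norm_sub_le _ _
      _ = 2 * ‖g 0‖ + e := by rw [norm_mul, ← dist_eq_norm, ← hw₁e, Complex.norm_two]
      _ ≤ 3 * ‖g 0‖ := by linarith
  have hgd : HasDerivAt g (deriv g 0) 0 :=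
    (hg.differentiableAt (isOpen_ball.mem_nhds h0B)).hasDerivAt
  have hfd : deriv f 0 = 2 * g 0 * deriv g 0 := by
    have h1 : HasDerivAt (fun u => g u ^ 2 + w₀) (2 * g 0 * deriv g 0) 0 := by
      simpa using (hgd.pow 2).add_const w₀
    have h2 : (fun u => g u ^ 2 + w₀) = f := by ext u; rw [hgsq]; ring
    rw [h2] at h1
    exact h1.deriv
  have hfar : ∀ u ∈ ball (0 : ℂ) 1, e ≤ ‖g u + g 0‖ := by
    intro u hu
    by_contra! h
    obtain ⟨v, hv, hv'⟩ := hball (show -g u ∈ ball (g 0) e by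
      rwa [mem_ball, dist_eq_norm, ← norm_neg, show -(-g u - g 0) = g u + g 0 by ring])
    exact hsum v hv u hu hv'
  have hnz : ∀ u ∈ ball (0 : ℂ) 1, g u + g 0 ≠ 0 := fun u hu h => by
    have := hfar u hu
    rw [h, norm_zero] at this
    linarith
  -- The image of `-g` misses the disk of radius `e` about `g 0`, so `1 / (g + g 0)` is bounded by
  -- `1 / e`; Cauchy's estimate at `0` applies.
  have hh : ‖deriv g 0‖ * e ≤ 8 * ‖g 0‖ ^ 2 := by
    have hdiff : DifferentiableOn ℂ (fun u => (g u + g 0)⁻¹) (ball 0 1) :=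
      (hg.add_const (g 0)).inv hnz
    have hb : ∀ u ∈ ball (0 : ℂ) 1, ‖(g u + g 0)⁻¹‖ ≤ e⁻¹ := fun u hu => by
      rw [norm_inv]; exact inv_anti₀ hep (hfar u hu)
    have h1 := Complex.norm_deriv_le_div_of_mapsTo_ball (R₂ := 2 * e⁻¹) hdiff (by
      intro u hu
      rw [mem_closedBall, dist_eq_norm]
      refine (norm_sub_le _ _).trans ?_
      linarith [hb u hu, hb 0 h0B]) one_pos
    have h2 : HasDerivAt (fun u => (g u + g 0)⁻¹) (-deriv g 0 / (g 0 + g 0) ^ 2) 0 :=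
      (hgd.add_const (g 0)).fun_inv (hnz 0 h0B)
    rw [h2.deriv, norm_div, norm_neg, norm_pow, ← two_mul, norm_mul, div_one,
      Complex.norm_two, div_le_iff₀ (by positivity)] at h1
    calc ‖deriv g 0‖ * e ≤ (2 * e⁻¹ * (2 * ‖g 0‖) ^ 2) * e :=
          mul_le_mul_of_nonneg_right h1 hep.le
      _ = 8 * ‖g 0‖ ^ 2 := by field_simp; ring
  have hgd' : ‖deriv g 0‖ ≤ 24 * ‖g 0‖ := by
    have h1 : ‖g 0‖ ≤ 3 * e := by
      rw [hdn] at hdle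
      nlinarith
    by_contra! h
    nlinarith [mul_lt_mul_of_pos_right h hep]
  rw [hfd, norm_mul, norm_mul, Complex.norm_two]
  nlinarith

/-! ### Automorphisms of the disk and the Schwarz–Pick lemma -/

/-- The automorphism of the unit disk that sends `a` to `0`. -/
def mob (a z : ℂ) : ℂ := (z - a) / (1 - conj a * z)

theorem one_sub_conj_mul_ne_zero {a z : ℂ} (ha : ‖a‖ < 1) (hz : ‖z‖ < 1) :
    1 - conj a * z ≠ 0 := by
  intro h
  have h1 : ‖conj a * z‖ = 1 := by rw [← sub_eq_zero.1 h, norm_one]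
  rw [norm_mul, Complex.norm_conj] at h1
  nlinarith [norm_nonneg a, norm_nonneg z]

theorem norm_one_sub_conj_mul_sq (a z : ℂ) :
    ‖1 - conj a * z‖ ^ 2 - ‖z - a‖ ^ 2 = (1 - ‖a‖ ^ 2) * (1 - ‖z‖ ^ 2) := by
  simp only [Complex.sq_norm, Complex.normSq_apply, Complex.sub_re, Complex.sub_im, Complex.mul_re,
    Complex.mul_im, Complex.conj_re, Complex.conj_im, Complex.one_re, Complex.one_im]
  ring

theorem one_sub_norm_mob_sq {a z : ℂ} (ha : ‖a‖ < 1) (hz : ‖z‖ < 1) :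
    1 - ‖mob a z‖ ^ 2 = (1 - ‖a‖ ^ 2) * (1 - ‖z‖ ^ 2) / ‖1 - conj a * z‖ ^ 2 := by
  have h : ‖1 - conj a * z‖ ≠ 0 := norm_ne_zero_iff.2 (one_sub_conj_mul_ne_zero ha hz)
  rw [← norm_one_sub_conj_mul_sq, mob, norm_div, div_pow, sub_div,
    div_self (pow_ne_zero 2 h)]

theorem one_sub_norm_sq_pos {z : ℂ} (hz : ‖z‖ < 1) : 0 < 1 - ‖z‖ ^ 2 := by
  nlinarith [norm_nonneg z]

theorem norm_mob_lt_one {a z : ℂ} (ha : ‖a‖ < 1) (hz : ‖z‖ < 1) : ‖mob a z‖ < 1 := by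
  have h : 0 < ‖1 - conj a * z‖ := norm_pos_iff.2 (one_sub_conj_mul_ne_zero ha hz)
  have h1 : 0 < 1 - ‖mob a z‖ ^ 2 := by
    rw [one_sub_norm_mob_sq ha hz]
    have := one_sub_norm_sq_pos ha
    have := one_sub_norm_sq_pos hz
    positivity
  nlinarith [norm_nonneg (mob a z)]

@[simp] theorem mob_self (a : ℂ) : mob a a = 0 := by simp [mob]

@[simp] theorem mob_zero_right (a : ℂ) : mob a 0 = -a := by simp [mob]

@[simp] theorem mob_zero_left (z : ℂ) : mob 0 z = z := by simp [mob]

theorem mob_neg_mob {a z : ℂ} (ha : ‖a‖ < 1) (hz : ‖z‖ < 1) : mob (-a) (mob a z) = z := by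
  have h := one_sub_conj_mul_ne_zero ha hz
  have h2 : 1 - conj a * a ≠ 0 := one_sub_conj_mul_ne_zero ha ha
  simp only [mob, map_neg]
  have e1 : (z - a) / (1 - conj a * z) - -a = z * (1 - conj a * a) / (1 - conj a * z) := by
    rw [eq_div_iff h, sub_mul, div_mul_cancel₀ _ h]; ring
  have e2 : 1 - -conj a * ((z - a) / (1 - conj a * z)) =
      (1 - conj a * a) / (1 - conj a * z) := by
    rw [eq_div_iff h, sub_mul, mul_assoc, div_mul_cancel₀ _ h]; ring
  rw [e1, e2, div_div_div_cancel_right₀ h, mul_div_assoc, div_self h2, mul_one]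

theorem hasDerivAt_mob {a z : ℂ} (ha : ‖a‖ < 1) (hz : ‖z‖ < 1) :
    HasDerivAt (mob a) ((1 - conj a * a) / (1 - conj a * z) ^ 2) z := by
  have h := one_sub_conj_mul_ne_zero ha hz
  have h1 : HasDerivAt (fun z => z - a) 1 z := (hasDerivAt_id z).sub_const a
  have h2 : HasDerivAt (fun z => 1 - conj a * z) (-(conj a)) z := by
    simpa using ((hasDerivAt_id z).const_mul (conj a)).const_sub 1
  refine (h1.div h2 h).congr_deriv ?_
  congr 1
  ring

theorem differentiableOn_mob {a : ℂ} (ha : ‖a‖ < 1) : DifferentiableOn ℂ (mob a) (ball 0 1) :=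
  fun _ hz => (hasDerivAt_mob ha (mem_ball_zero_iff.1 hz)).differentiableAt.differentiableWithinAt

theorem mapsTo_mob {a : ℂ} (ha : ‖a‖ < 1) : MapsTo (mob a) (ball 0 1) (ball 0 1) :=
  fun _ hz => mem_ball_zero_iff.2 (norm_mob_lt_one ha (mem_ball_zero_iff.1 hz))

theorem norm_deriv_mob_div {a z : ℂ} (ha : ‖a‖ < 1) (hz : ‖z‖ < 1) :
    ‖(1 - conj a * a) / (1 - conj a * z) ^ 2‖ / (1 - ‖mob a z‖ ^ 2) = 1 / (1 - ‖z‖ ^ 2) := by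
  have h : ‖1 - conj a * z‖ ≠ 0 := norm_ne_zero_iff.2 (one_sub_conj_mul_ne_zero ha hz)
  have h1 := (one_sub_norm_sq_pos ha)
  have h2 := (one_sub_norm_sq_pos hz).ne'
  have h3 : ‖1 - conj a * a‖ = 1 - ‖a‖ ^ 2 := by
    rw [Complex.conj_mul', ← Complex.ofReal_pow, ← Complex.ofReal_one, ← Complex.ofReal_sub,
      Complex.norm_real, Real.norm_of_nonneg h1.le]
  rw [one_sub_norm_mob_sq ha hz, norm_div, norm_pow, h3]
  have := h1.ne'
  field_simp

/-- The **Schwarz–Pick lemma**. -/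
theorem norm_mob_le_of_mapsTo {f : ℂ → ℂ} (hf : DifferentiableOn ℂ f (ball 0 1))
    (hmaps : MapsTo f (ball 0 1) (ball 0 1)) {u v : ℂ} (hu : ‖u‖ < 1) (hv : ‖v‖ < 1) :
    ‖mob (f u) (f v)‖ ≤ ‖mob u v‖ := by
  have hfu : ‖f u‖ < 1 := mem_ball_zero_iff.1 (hmaps (mem_ball_zero_iff.2 hu))
  have hnu : ‖-u‖ < 1 := by rwa [norm_neg]
  set h : ℂ → ℂ := fun z => mob (f u) (f (mob (-u) z)) with hh
  have hd : DifferentiableOn ℂ h (ball 0 1) :=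
    (differentiableOn_mob hfu).comp (hf.comp (differentiableOn_mob hnu) (mapsTo_mob hnu))
      (hmaps.comp (mapsTo_mob hnu))
  have hm : MapsTo h (ball 0 1) (closedBall 0 1) := fun z hz =>
    ball_subset_closedBall (mapsTo_mob hfu (hmaps (mapsTo_mob hnu hz)))
  have h0 : h 0 = 0 := by simp [hh]
  have h1 := Complex.norm_le_norm_of_mapsTo_ball hd hm h0 (norm_mob_lt_one hu hv)
  simpa [hh, mob_neg_mob hu hv] using h1

/-! ### Hyperbolic length and distance in the disk -/

theorem hasDerivAt_artanh {x : ℝ} (hx : |x| < 1) :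
    HasDerivAt Real.artanh (1 / (1 - x ^ 2)) x := by
  obtain ⟨h1, h2⟩ := abs_lt.1 hx
  have hp : (1 : ℝ) + x ≠ 0 := by linarith
  have hm : (1 : ℝ) - x ≠ 0 := by linarith
  have hd : HasDerivAt (fun y : ℝ => 1 / 2 * (Real.log (1 + y) - Real.log (1 - y)))
      (1 / (1 - x ^ 2)) x := by
    have e1 : HasDerivAt (fun y : ℝ => Real.log (1 + y)) (1 / (1 + x)) x :=
      ((hasDerivAt_id x).const_add 1).log hp
    have e2 : HasDerivAt (fun y : ℝ => Real.log (1 - y)) (-1 / (1 - x)) x :=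
      ((hasDerivAt_id x).const_sub 1).log hm
    refine ((e1.sub e2).const_mul (1 / 2)).congr_deriv ?_
    have : 1 - x ^ 2 ≠ 0 := by
      rw [show 1 - x ^ 2 = (1 + x) * (1 - x) by ring]; exact mul_ne_zero hp hm
    field_simp
    ring
  refine hd.congr_of_eventuallyEq ?_
  filter_upwards [Ioo_mem_nhds h1 h2] with y hy
  have hy1 : (1 : ℝ) + y ≠ 0 := by linarith [hy.1]
  have hy2 : (1 : ℝ) - y ≠ 0 := by linarith [hy.2]
  rw [Real.artanh_eq_half_log (Ioo_subset_Icc_self hy), Real.log_div hy1 hy2]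

theorem norm_lt_one_of_mem {z : ℂ} (hz : z ∈ unitDisk) : ‖z‖ < 1 := mem_ball_zero_iff.1 hz

/-- The hyperbolic length is invariant under automorphisms of the disk. -/
theorem diskHypLength_mob {a : ℂ} (ha : ‖a‖ < 1) {γ : ℝ → ℂ} (hγ : ContDiffOn ℝ 1 γ (Icc 0 1))
    (hmaps : MapsTo γ (Icc 0 1) unitDisk) :
    diskHypLength (fun t => mob a (γ t)) = diskHypLength γ := by
  unfold diskHypLength
  refine intervalIntegral.integral_congr fun t ht => ?_
  rw [uIcc_of_le zero_le_one] at ht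
  have hz := norm_lt_one_of_mem (hmaps ht)
  have hd : HasDerivWithinAt γ (derivWithin γ (Icc 0 1) t) (Icc 0 1) t :=
    (hγ.differentiableOn one_ne_zero t ht).hasDerivWithinAt
  have h1 := ((hasDerivAt_mob ha hz).comp_hasDerivWithinAt t hd).derivWithin
    (uniqueDiffOn_Icc_zero_one t ht)
  change derivWithin (fun t => mob a (γ t)) _ _ = _ at h1
  simp only [h1, norm_mul]
  rw [mul_comm, mul_div_assoc, norm_deriv_mob_div ha hz, mul_one_div]

theorem contDiffOn_mob_comp {a : ℂ} (ha : ‖a‖ < 1) {γ : ℝ → ℂ} (hγ : ContDiffOn ℝ 1 γ (Icc 0 1))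
    (hmaps : MapsTo γ (Icc 0 1) unitDisk) :
    ContDiffOn ℝ 1 (fun t => mob a (γ t)) (Icc 0 1) :=
  (hγ.sub contDiffOn_const).mul ((contDiffOn_const.sub (contDiffOn_const.mul hγ)).inv
    fun _ ht => one_sub_conj_mul_ne_zero ha (norm_lt_one_of_mem (hmaps ht)))

/-- Project the curve orthogonally to the diameter through its endpoint: both `|dz|` and `1 / (1 -
|z|^2)` can only decrease, and on the diameter the length element is the derivative of `artanh`. -/
theorem artanh_norm_le_diskHypLength {γ : ℝ → ℂ} (hγ : ContDiffOn ℝ 1 γ (Icc 0 1))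
    (hmaps : MapsTo γ (Icc 0 1) unitDisk) (h0 : γ 0 = 0) :
    Real.artanh ‖γ 1‖ ≤ diskHypLength γ := by
  obtain ⟨e, he, hev⟩ : ∃ e : ℂ, ‖e‖ = 1 ∧ (e * γ 1).re = ‖γ 1‖ := by
    rcases eq_or_ne (γ 1) 0 with h | h
    · exact ⟨1, by simp, by simp [h]⟩
    · refine ⟨conj (γ 1) / ‖γ 1‖, ?_, ?_⟩
      · rw [norm_div, Complex.norm_conj, Complex.norm_real, norm_norm, div_self (by simpa)]
      · have : (‖γ 1‖ : ℂ) ≠ 0 := by simpa using h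
        rw [div_mul_eq_mul_div, Complex.conj_mul', pow_two, mul_div_assoc, div_self this]
        simp
  set x : ℝ → ℝ := fun t => (e * γ t).re with hx
  have hxn : ∀ t, |x t| ≤ ‖γ t‖ := fun t => by
    refine (Complex.abs_re_le_norm _).trans ?_
    rw [norm_mul, he, one_mul]
  have hx1 : ∀ t ∈ Icc (0 : ℝ) 1, |x t| < 1 := fun t ht =>
    (hxn t).trans_lt (norm_lt_one_of_mem (hmaps ht))
  have hud := uniqueDiffOn_Icc_zero_one
  have hxd : ∀ t ∈ Icc (0 : ℝ) 1,
      HasDerivWithinAt x ((e * derivWithin γ (Icc 0 1) t).re) (Icc 0 1) t := fun t ht => by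
    have hd : HasDerivWithinAt γ (derivWithin γ (Icc 0 1) t) (Icc 0 1) t :=
      (hγ.differentiableOn one_ne_zero t ht).hasDerivWithinAt
    exact Complex.reCLM.hasFDerivAt.comp_hasDerivWithinAt t (hd.const_mul e)
  have hgd : ∀ t ∈ Icc (0 : ℝ) 1, HasDerivWithinAt (fun t => Real.artanh (x t))
      (1 / (1 - x t ^ 2) * (e * derivWithin γ (Icc 0 1) t).re) (Icc 0 1) t := fun t ht =>
    (hasDerivAt_artanh (hx1 t ht)).comp_hasDerivWithinAt t (hxd t ht)
  have hcont : ContinuousOn (fun t => ‖derivWithin γ (Icc 0 1) t‖ / (1 - ‖γ t‖ ^ 2))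
      (Icc 0 1) := by
    refine (hγ.continuousOn_derivWithin hud le_rfl).norm.div
      (continuousOn_const.sub (hγ.continuousOn.norm.pow 2)) fun t ht => ?_
    exact (one_sub_norm_sq_pos (norm_lt_one_of_mem (hmaps ht))).ne'
  have key := intervalIntegral.sub_le_integral_of_hasDeriv_right_of_le (a := 0) (b := 1)
    (g := fun t => Real.artanh (x t))
    (g' := fun t => 1 / (1 - x t ^ 2) * (e * derivWithin γ (Icc 0 1) t).re)
    (φ := fun t => ‖derivWithin γ (Icc 0 1) t‖ / (1 - ‖γ t‖ ^ 2)) zero_le_one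
    (fun t ht => (hgd t ht).continuousWithinAt)
    (fun t ht => ((hgd t (Ioo_subset_Icc_self ht)).hasDerivAt
      (Icc_mem_nhds ht.1 ht.2)).hasDerivWithinAt)
    (hcont.integrableOn_Icc) (fun t ht => by
      have ht' := Ioo_subset_Icc_self ht
      have hp := one_sub_norm_sq_pos (norm_lt_one_of_mem (hmaps ht'))
      have hle : 1 - ‖γ t‖ ^ 2 ≤ 1 - x t ^ 2 := by
        have := pow_le_pow_left₀ (abs_nonneg _) (hxn t) 2
        rw [sq_abs] at this
        linarith
      have hre : (e * derivWithin γ (Icc 0 1) t).re ≤ ‖derivWithin γ (Icc 0 1) t‖ := by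
        refine (Complex.re_le_norm _).trans ?_
        rw [norm_mul, he, one_mul]
      rw [one_div_mul_eq_div]
      calc _ ≤ ‖derivWithin γ (Icc 0 1) t‖ / (1 - x t ^ 2) :=
            div_le_div_of_nonneg_right hre (hp.le.trans hle)
        _ ≤ _ := div_le_div_of_nonneg_left (norm_nonneg _) hp hle)
  have e0 : x 0 = 0 := by simp [hx, h0]
  have e1 : x 1 = ‖γ 1‖ := hev
  simpa [e0, e1, diskHypLength] using key

theorem diskHypLength_segment {v : ℂ} (hv : ‖v‖ < 1) :
    diskHypLength (fun t => (t : ℂ) * v) = Real.artanh ‖v‖ := by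
  have hn : ∀ t ∈ Icc (0 : ℝ) 1, |t * ‖v‖| < 1 := fun t ht => by
    rw [abs_of_nonneg (mul_nonneg ht.1 (norm_nonneg v))]
    nlinarith [ht.1, ht.2, norm_nonneg v]
  have h1 : diskHypLength (fun t => (t : ℂ) * v) =
      ∫ t in (0 : ℝ)..1, 1 / (1 - (t * ‖v‖) ^ 2) * ‖v‖ := by
    refine intervalIntegral.integral_congr fun t ht => ?_
    rw [uIcc_of_le zero_le_one] at ht
    have hd : HasDerivAt (fun t : ℝ => (t : ℂ) * v) v t := by
      simpa using (Complex.ofRealCLM.hasDerivAt (x := t)).mul_const v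
    simp only [hd.hasDerivWithinAt.derivWithin (uniqueDiffOn_Icc_zero_one t ht), norm_mul,
      Complex.norm_real, Real.norm_of_nonneg ht.1]
    rw [one_div_mul_eq_div]
  have hd : ∀ t ∈ uIcc (0 : ℝ) 1, HasDerivAt (fun t => Real.artanh (t * ‖v‖))
      (1 / (1 - (t * ‖v‖) ^ 2) * ‖v‖) t := fun t ht => by
    rw [uIcc_of_le zero_le_one] at ht
    have h2 : HasDerivAt (fun t : ℝ => t * ‖v‖) ‖v‖ t := by
      simpa using (hasDerivAt_id t).mul_const ‖v‖
    exact HasDerivAt.comp (h₂ := Real.artanh) t (hasDerivAt_artanh (hn t ht)) h2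
  rw [h1, intervalIntegral.integral_eq_sub_of_hasDerivAt hd]
  · simp
  · refine ContinuousOn.intervalIntegrable fun t ht => ?_
    rw [uIcc_of_le zero_le_one] at ht
    refine ContinuousAt.continuousWithinAt ?_
    have : 1 - (t * ‖v‖) ^ 2 ≠ 0 := by
      have := (sq_lt_one_iff_abs_lt_one _).2 (hn t ht)
      linarith
    fun_prop (disch := assumption)

/-- The explicit formula for the hyperbolic distance of the disk. -/
theorem diskHypDist_eq {u v : ℂ} (hu : ‖u‖ < 1) (hv : ‖v‖ < 1) :
    diskHypDist u v = Real.artanh ‖mob u v‖ := by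
  have hle : ∀ L ∈ {L : ℝ | ∃ γ : ℝ → ℂ, ContDiffOn ℝ 1 γ (Icc 0 1) ∧
      MapsTo γ (Icc 0 1) unitDisk ∧ γ 0 = u ∧ γ 1 = v ∧ L = diskHypLength γ},
      Real.artanh ‖mob u v‖ ≤ L := by
    rintro L ⟨γ, hγ, hm, h0, h1, rfl⟩
    rw [← diskHypLength_mob hu hγ hm]
    have := artanh_norm_le_diskHypLength (contDiffOn_mob_comp hu hγ hm)
      (fun t ht => mapsTo_mob hu (hm ht)) (by simp [h0])
    simpa [h1] using this
  -- Both open goals, that the bound is attained and that the set of lengths is nonempty, are met by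
  -- one curve: the segment from `0` to `mob u v`, moved back by `mob (-u)`.
  refine le_antisymm (csInf_le ⟨_, hle⟩ ?_) (le_csInf ?_ hle) <;>
  · have hnu : ‖-u‖ < 1 := by rwa [norm_neg]
    have hw := norm_mob_lt_one hu hv
    have hc : ContDiffOn ℝ 1 (fun t : ℝ => (t : ℂ) * mob u v) (Icc 0 1) :=
      (Complex.ofRealCLM.contDiff.mul contDiff_const).contDiffOn
    have hm : MapsTo (fun t : ℝ => (t : ℂ) * mob u v) (Icc 0 1) unitDisk := fun t ht => by
      rw [unitDisk, mem_ball_zero_iff, norm_mul, Complex.norm_real, Real.norm_of_nonneg ht.1]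
      nlinarith [ht.1, ht.2, norm_nonneg (mob u v)]
    first
    | exact ⟨fun t => mob (-u) ((t : ℂ) * mob u v), contDiffOn_mob_comp hnu hc hm,
        fun t ht => mapsTo_mob hnu (hm ht), by simp, by simp [mob_neg_mob hu hv], by
        rw [diskHypLength_mob hnu hc hm, diskHypLength_segment hw]⟩
    | exact ⟨_, fun t => mob (-u) ((t : ℂ) * mob u v), contDiffOn_mob_comp hnu hc hm,
        fun t ht => mapsTo_mob hnu (hm ht), by simp, by simp [mob_neg_mob hu hv], rfl⟩

/-! ### Hyperbolic distance and geodesics in `D` -/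

theorem IsConformalOnto.injOn {φ : ℂ → ℂ} {D : Set ℂ} (hφ : IsConformalOnto φ D) :
    InjOn φ (ball 0 1) := hφ.bijOn.injOn

theorem IsConformalOnto.image_eq {φ : ℂ → ℂ} {D : Set ℂ} (hφ : IsConformalOnto φ D) :
    φ '' ball 0 1 = D := hφ.bijOn.image_eq

/-- A conformal map onto `D` has a holomorphic inverse on `D`. -/
theorem IsConformalOnto.exists_inverse {φ : ℂ → ℂ} {D : Set ℂ} (hφ : IsConformalOnto φ D) :
    ∃ g : ℂ → ℂ, DifferentiableOn ℂ g D ∧ MapsTo g D (ball 0 1) ∧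
      (∀ u, ‖u‖ < 1 → g (φ u) = u) ∧ ∀ y ∈ D, φ (g y) = y := by
  have hl : LeftInvOn (Function.invFunOn φ (ball 0 1)) φ (ball 0 1) := hφ.injOn.leftInvOn_invFunOn
  refine ⟨Function.invFunOn φ (ball 0 1), ?_, ?_, ?_, ?_⟩
  · rw [← hφ.image_eq]
    exact differentiableOn_of_leftInvOn isOpen_ball hφ.differentiableOn hφ.injOn hl
  · exact hφ.bijOn.surjOn.mapsTo_invFunOn
  · exact fun u hu => hl (mem_ball_zero_iff.2 hu)
  · exact fun y hy => hφ.bijOn.surjOn.rightInvOn_invFunOn hy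

/-- Schwarz–Pick for `ψ⁻¹ ∘ φ`. Used with the roles of `φ` and `ψ` exchanged as well, it shows that
the transported distance does not depend on the conformal map. -/
theorem norm_mob_le_of_eq {φ ψ : ℂ → ℂ} {D : Set ℂ} (hφ : IsConformalOnto φ D)
    (hψ : IsConformalOnto ψ D) {u v u' v' : ℂ} (hu : ‖u‖ < 1) (hv : ‖v‖ < 1) (hu' : ‖u'‖ < 1)
    (hv' : ‖v'‖ < 1) (huu : ψ u' = φ u) (hvv : ψ v' = φ v) : ‖mob u' v'‖ ≤ ‖mob u v‖ := by
  obtain ⟨g, hg, hgm, hgl, -⟩ := hψ.exists_inverse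
  have hm : MapsTo φ (ball 0 1) D := hφ.bijOn.mapsTo
  have h := norm_mob_le_of_mapsTo (hg.comp hφ.differentiableOn hm) (hgm.comp hm) hu hv
  simpa only [Function.comp_apply, ← huu, ← hvv, hgl _ hu', hgl _ hv'] using h

/-- The hyperbolic distance of `D` in the coordinates given by a conformal map. -/
theorem hypDist_eq {φ : ℂ → ℂ} {D : Set ℂ} (hφ : IsConformalOnto φ D) {u v : ℂ}
    (hu : ‖u‖ < 1) (hv : ‖v‖ < 1) : hypDist D (φ u) (φ v) = Real.artanh ‖mob u v‖ := by
  have : {r : ℝ | ∃ ψ : ℂ → ℂ, IsConformalOnto ψ D ∧ ∃ u' ∈ unitDisk, ∃ v' ∈ unitDisk,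
      ψ u' = φ u ∧ ψ v' = φ v ∧ r = diskHypDist u' v'} = {Real.artanh ‖mob u v‖} := by
    ext r
    simp only [mem_ofPred_eq, mem_singleton_iff]
    constructor
    · rintro ⟨ψ, hψ, u', hu', v', hv', huu, hvv, rfl⟩
      replace hu' := norm_lt_one_of_mem hu'
      replace hv' := norm_lt_one_of_mem hv'
      rw [diskHypDist_eq hu' hv']
      congr 1
      exact le_antisymm (norm_mob_le_of_eq hφ hψ hu hv hu' hv' huu hvv)
        (norm_mob_le_of_eq hψ hφ hu' hv' hu hv huu.symm hvv.symm)
    · rintro rfl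
      exact ⟨φ, hφ, u, mem_ball_zero_iff.2 hu, v, mem_ball_zero_iff.2 hv, rfl, rfl,
        (diskHypDist_eq hu hv).symm⟩
  rw [hypDist, this, csInf_singleton]

theorem one_sub_tanh_sq (x : ℝ) : 1 - Real.tanh x ^ 2 = 1 / Real.cosh x ^ 2 := by
  have h := (Real.cosh_pos x).ne'
  rw [Real.tanh_eq_sinh_div_cosh, div_pow, eq_div_iff (pow_ne_zero 2 h), sub_mul,
    div_mul_cancel₀ _ (pow_ne_zero 2 h), one_mul, Real.cosh_sq]
  ring

/-- The case of two real points in `one_sub_norm_mob_sq`, against which arbitrary points of the same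
moduli are compared. -/
theorem one_sub_tanh_sub_sq_mul (x y : ℝ) :
    (1 - Real.tanh (x - y) ^ 2) * (1 - Real.tanh x * Real.tanh y) ^ 2 =
      (1 - Real.tanh x ^ 2) * (1 - Real.tanh y ^ 2) := by
  have hx := (Real.cosh_pos x).ne'
  have hy := (Real.cosh_pos y).ne'
  have hxy := (Real.cosh_pos (x - y)).ne'
  have h : 1 - Real.tanh x * Real.tanh y =
      Real.cosh (x - y) / (Real.cosh x * Real.cosh y) := by
    rw [Real.tanh_eq_sinh_div_cosh, Real.tanh_eq_sinh_div_cosh, Real.cosh_sub]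
    field_simp
  rw [h, one_sub_tanh_sq, one_sub_tanh_sq, one_sub_tanh_sq]
  field_simp

/-- Two points of the disk at hyperbolic distances `s`, `t` from the origin and `|s - t|` from each
other lie on the same radius. -/
theorem smul_eq_smul_of_norm_mob {u v : ℂ} {s t : ℝ}
    (hu : ‖u‖ = Real.tanh s) (hv : ‖v‖ = Real.tanh t) (h : ‖mob u v‖ ^ 2 = Real.tanh (s - t) ^ 2) :
    (Real.tanh s : ℂ) * v = (Real.tanh t : ℂ) * u := by
  have hu1 : ‖u‖ < 1 := hu ▸ Real.tanh_lt_one s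
  have hv1 : ‖v‖ < 1 := hv ▸ Real.tanh_lt_one t
  have hne : ‖1 - conj u * v‖ ≠ 0 := norm_ne_zero_iff.2 (one_sub_conj_mul_ne_zero hu1 hv1)
  have h1 := one_sub_norm_mob_sq hu1 hv1
  have h2 := one_sub_tanh_sub_sq_mul s t
  rw [h, eq_div_iff (pow_ne_zero 2 hne), hu, hv, ← h2] at h1
  have hpos : 1 - Real.tanh (s - t) ^ 2 ≠ 0 := by
    rw [one_sub_tanh_sq]; have := Real.cosh_pos (s - t); positivity
  have h3 := mul_left_cancel₀ hpos h1
  have hnu : u.re * u.re + u.im * u.im = Real.tanh s ^ 2 := by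
    rw [← hu, Complex.sq_norm, Complex.normSq_apply]
  have hnv : v.re * v.re + v.im * v.im = Real.tanh t ^ 2 := by
    rw [← hv, Complex.sq_norm, Complex.normSq_apply]
  rw [Complex.sq_norm, Complex.normSq_apply] at h3
  simp only [Complex.sub_re, Complex.sub_im, Complex.mul_re,
    Complex.mul_im, Complex.conj_re, Complex.conj_im, Complex.one_re, Complex.one_im] at h3
  -- The hypothesis fixes `|1 - conj u * v|`, hence the inner product of `u` and `v`; this is
  -- equality in Cauchy–Schwarz, which forces collinearity.
  have hre : u.re * v.re + u.im * v.im = Real.tanh s * Real.tanh t := by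
    linear_combination (-1 / 2) * h3 + (1 / 2) * (v.re * v.re + v.im * v.im) * hnu +
      (1 / 2) * Real.tanh s ^ 2 * hnv
  rw [← sub_eq_zero, ← norm_eq_zero, ← sq_eq_zero_iff, Complex.sq_norm, Complex.normSq_apply]
  simp only [Complex.sub_re, Complex.sub_im, Complex.mul_re, Complex.mul_im, Complex.ofReal_re,
    Complex.ofReal_im]
  linear_combination Real.tanh t ^ 2 * hnu + Real.tanh s ^ 2 * hnv -
    2 * Real.tanh s * Real.tanh t * hre

theorem tendsto_artanh_nhdsLT_one : Tendsto Real.artanh (𝓝[<] 1) atTop := by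
  refine tendsto_atTop.2 fun b => ?_
  filter_upwards [Ioo_mem_nhdsLT (Real.tanh_lt_one b)] with r hr
  have h1 : -1 < r := (Real.neg_one_lt_tanh b).trans hr.1
  rw [← Real.artanh_tanh b]
  exact Real.artanh_le_artanh (Real.neg_one_lt_tanh b) hr.2 hr.1.le

/-- Hyperbolic geodesics from `φ 0` are the images of the radii of the disk. -/
theorem IsHypGeodesic.exists_radius {φ : ℂ → ℂ} {D : Set ℂ} {z w : ℂ} {γ : ℝ≥0 → ℂ}
    (hγ : IsHypGeodesic D z w γ) (hφ : IsConformalOnto φ D) (hφ0 : φ 0 = z) :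
    ∃ ζ ∈ sphere (0 : ℂ) 1, Tendsto (fun r : ℝ => φ (r * ζ)) (𝓝[<] 1) (𝓝 w) ∧
      ∀ t, ∃ r : ℝ, 0 ≤ r ∧ r < 1 ∧ γ t = φ (r * ζ) := by
  obtain ⟨g, -, hgm, -, hgr⟩ := hφ.exists_inverse
  set p : ℝ≥0 → ℂ := fun t => g (γ t) with hp
  have hpn : ∀ t, ‖p t‖ < 1 := fun t => mem_ball_zero_iff.1 (hgm (hγ.mem t))
  have hφp : ∀ t, φ (p t) = γ t := fun t => hgr _ (hγ.mem t)
  have hp0 : p 0 = 0 := hφ.injOn (mem_ball_zero_iff.2 (hpn 0)) (by simp)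
    (by rw [hφp, hγ.start, hφ0])
  have hdist : ∀ s t, ‖mob (p s) (p t)‖ = Real.tanh (dist s t) := fun s t => by
    have h := hγ.unit_speed s t
    rw [← hφp, ← hφp, hypDist_eq hφ (hpn s) (hpn t)] at h
    have hm := norm_mob_lt_one (hpn s) (hpn t)
    rw [← h, Real.tanh_artanh ⟨by linarith [norm_nonneg (mob (p s) (p t))], hm⟩]
  have hnorm : ∀ t, ‖p t‖ = Real.tanh t := fun t => by
    have h := hdist 0 t
    rwa [hp0, mob_zero_left, NNReal.dist_eq, NNReal.coe_zero, zero_sub, abs_neg,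
      abs_of_nonneg t.coe_nonneg] at h
  have htp : 0 < Real.tanh 1 := by
    rw [Real.tanh_eq_sinh_div_cosh]
    exact div_pos (Real.sinh_pos_iff.2 one_pos) (Real.cosh_pos 1)
  -- Every point of the geodesic is compared with the one at time `1`, which fixes the direction of
  -- the radius.
  have hcol : ∀ t : ℝ≥0, p t = (Real.tanh t : ℂ) * (p 1 / (Real.tanh 1 : ℂ)) := fun t => by
    have h := smul_eq_smul_of_norm_mob (u := p 1) (v := p t) (s := 1) (t := t)
      (by simpa using hnorm 1) (hnorm t) (by
        rw [hdist, NNReal.dist_eq, NNReal.coe_one]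
        rcases abs_choice (1 - (t : ℝ)) with h | h <;> rw [h]
        rw [Real.tanh_neg, neg_sq])
    have h0 : (Real.tanh 1 : ℂ) ≠ 0 := by exact_mod_cast htp.ne'
    rw [← mul_div_assoc, eq_div_iff h0, mul_comm, h]
  set ζ := p 1 / (Real.tanh 1 : ℂ) with hζ
  refine ⟨ζ, ?_, ?_, fun t => ⟨Real.tanh t, ?_, Real.tanh_lt_one t, ?_⟩⟩
  · rw [mem_sphere_zero_iff_norm, hζ, norm_div, hnorm, Complex.norm_real,
      Real.norm_of_nonneg htp.le]
    exact div_self htp.ne'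
  · have h1 : Tendsto (fun r : ℝ => γ (Real.artanh r).toNNReal) (𝓝[<] 1) (𝓝 w) :=
      hγ.tendsto.comp (Real.tendsto_toNNReal_atTop.comp tendsto_artanh_nhdsLT_one)
    refine h1.congr' ?_
    filter_upwards [Ioo_mem_nhdsLT (zero_lt_one' ℝ)] with r hr
    rw [← hφp, hcol, Real.coe_toNNReal _ (Real.artanh_nonneg hr.1.le),
      Real.tanh_artanh ⟨by linarith [hr.1], hr.2⟩]
  · rw [← hnorm]; exact norm_nonneg _
  · rw [← hφp, hcol]

/-! ### Distance to the boundary and distortion of conformal maps -/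

theorem ball_infDist_compl_subset (D : Set ℂ) (p : ℂ) : ball p (infDist p Dᶜ) ⊆ D := by
  intro y hy
  by_contra h
  have := infDist_le_dist_of_mem (x := p) (s := Dᶜ) h
  rw [mem_ball, dist_comm] at hy
  exact absurd hy (not_lt.2 this)

theorem infDist_le_add_norm (D : Set ℂ) (p q : ℂ) :
    infDist q Dᶜ ≤ infDist p Dᶜ + ‖q - p‖ := by
  rw [← dist_eq_norm]; exact infDist_le_infDist_add_dist

/-- For a point of an open set, the distance to the boundary is the distance to the complement. -/
theorem infDist_frontier_eq {D : Set ℂ} (hD : IsOpen D) {p : ℂ} (hp : p ∈ D)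
    (hne : (frontier D).Nonempty) : infDist p (frontier D) = infDist p Dᶜ := by
  have hsub : frontier D ⊆ Dᶜ := fun x hx => by rw [hD.frontier_eq] at hx; exact hx.2
  refine le_antisymm ?_ (infDist_le_infDist_of_subset hsub hne)
  refine (le_infDist (hne.mono hsub)).2 fun {y} hy => ?_
  have hpre : IsPreconnected (segment ℝ p y) := (convex_segment p y).isPreconnected
  obtain ⟨x, hx, hxf⟩ : (segment ℝ p y ∩ frontier D).Nonempty := by
    by_contra hcon
    rw [not_nonempty_iff_eq_empty] at hcon
    have hcov : segment ℝ p y ⊆ D ∪ (closure D)ᶜ := fun x hx => by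
      by_contra hx'
      rw [mem_union, not_or, mem_compl_iff, not_not] at hx'
      exact (hcon ▸ ⟨hx, by rw [hD.frontier_eq]; exact ⟨hx'.2, hx'.1⟩⟩ : x ∈ (∅ : Set ℂ))
    obtain ⟨x, -, hxD, hxc⟩ := hpre D (closure D)ᶜ hD isClosed_closure.isOpen_compl hcov
      ⟨p, left_mem_segment ℝ p y, hp⟩ ⟨y, right_mem_segment ℝ p y,
        (hcov (right_mem_segment ℝ p y)).resolve_left hy⟩
    exact hxc (subset_closure hxD)
  refine (infDist_le_dist_of_mem hxf).trans ?_
  rw [← dist_add_dist_of_mem_segment hx]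
  linarith [dist_nonneg (x := x) (y := y)]


section

variable {φ : ℂ → ℂ} {D : Set ℂ}

/-- The Koebe estimate for a conformal map onto `D`. -/
theorem IsConformalOnto.norm_deriv_le (hφ : IsConformalOnto φ D) (hne : Dᶜ.Nonempty) {u : ℂ}
    (hu : ‖u‖ < 1) : (1 - ‖u‖) * ‖deriv φ u‖ ≤ 48 * infDist (φ u) Dᶜ := by
  have hr : 0 < 1 - ‖u‖ := by linarith
  set r : ℝ := 1 - ‖u‖ with hrd
  set A : ℂ → ℂ := fun v => u + r * v with hA
  have hAm : MapsTo A (ball 0 1) (ball 0 1) := fun v hv => by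
    rw [mem_ball_zero_iff] at hv ⊢
    calc ‖u + r * v‖ ≤ ‖u‖ + r * ‖v‖ := by
          refine (norm_add_le _ _).trans ?_
          rw [norm_mul, Complex.norm_real, Real.norm_of_nonneg hr.le]
      _ < ‖u‖ + r * 1 := by gcongr
      _ = 1 := by rw [hrd]; ring
  have hAd : ∀ v, HasDerivAt A r v := fun v => by
    have h1 : HasDerivAt (fun v : ℂ => (r : ℂ) * v) r v := by
      simpa using (hasDerivAt_id v).const_mul (r : ℂ)
    exact h1.const_add u
  have hAi : Function.Injective A := fun v w h => by
    have : (r : ℂ) ≠ 0 := by exact_mod_cast hr.ne'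
    simpa [hA, this] using h
  have hd : DifferentiableOn ℂ (φ ∘ A) (ball 0 1) :=
    hφ.differentiableOn.comp (fun v _ => (hAd v).differentiableAt.differentiableWithinAt) hAm
  have hsub : Dᶜ ⊆ ((φ ∘ A) '' ball 0 1)ᶜ := by
    rw [compl_subset_compl]
    rintro _ ⟨v, hv, rfl⟩
    exact hφ.bijOn.mapsTo (hAm hv)
  have h := norm_deriv_zero_le_of_injOn hd (hφ.injOn.comp hAi.injOn hAm) (hne.mono hsub)
  have hA0 : A 0 = u := by simp [hA]
  have hder : deriv (φ ∘ A) 0 = deriv φ u * r := by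
    have h1 : HasDerivAt φ (deriv φ u) (A 0) := by
      rw [hA0]
      exact (hφ.differentiableOn.differentiableAt
        (isOpen_ball.mem_nhds (mem_ball_zero_iff.2 hu))).hasDerivAt
    exact (h1.comp 0 (hAd 0)).deriv
  rw [hder, norm_mul, Complex.norm_real, Real.norm_of_nonneg hr.le, Function.comp_apply, hA0,
    mul_comm] at h
  exact h.trans (mul_le_mul_of_nonneg_left (infDist_le_infDist_of_subset hsub hne) (by norm_num))

/-- Growth of a conformal map over a bounded hyperbolic distance. -/
theorem IsConformalOnto.norm_sub_le_exp (hφ : IsConformalOnto φ D) (hne : Dᶜ.Nonempty) {u v : ℂ}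
    {h A : ℝ} (hh : 0 < h) (hA : 0 < A) (hu : ‖u‖ ≤ 1 - h) (hv : ‖v‖ ≤ 1 - h)
    (huv : ‖v - u‖ ≤ A * h) :
    ‖φ v - φ u‖ ≤ Real.exp (48 * A) * infDist (φ u) Dᶜ := by
  set ℓ : ℝ → ℂ := fun t => u + (t : ℂ) * (v - u) with hℓ
  have hℓn : ∀ t ∈ Icc (0 : ℝ) 1, ‖ℓ t‖ ≤ 1 - h := fun t ht => by
    have h1 : ℓ t = ((1 - t : ℝ) : ℂ) * u + (t : ℂ) * v := by simp only [hℓ]; push_cast; ring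
    rw [h1]
    refine (norm_add_le _ _).trans ?_
    rw [norm_mul, norm_mul, Complex.norm_real, Complex.norm_real, Real.norm_of_nonneg ht.1,
      Real.norm_of_nonneg (sub_nonneg.2 ht.2)]
    nlinarith [ht.1, ht.2]
  have hℓd : ∀ t, HasDerivAt ℓ (v - u) t := fun t => by
    have h1 : HasDerivAt (fun t : ℝ => (t : ℂ) * (v - u)) (v - u) t := by
      simpa using (Complex.ofRealCLM.hasDerivAt (x := t)).mul_const (v - u)
    exact h1.const_add u
  have hqd : ∀ t ∈ Icc (0 : ℝ) 1,
      HasDerivAt (fun t => φ (ℓ t) - φ u) (deriv φ (ℓ t) * (v - u)) t := fun t ht => by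
    have hmem : ℓ t ∈ ball (0 : ℂ) 1 := mem_ball_zero_iff.2 ((hℓn t ht).trans_lt (by linarith))
    have h1 : HasDerivAt φ (deriv φ (ℓ t)) (ℓ t) :=
      (hφ.differentiableOn.differentiableAt (isOpen_ball.mem_nhds hmem)).hasDerivAt
    exact (h1.comp t (hℓd t)).sub_const _
  set d := infDist (φ u) Dᶜ with hd
  have hd0 : 0 ≤ d := infDist_nonneg
  -- On the segment `1 - ‖ℓ t‖ ≥ h`, and the distance to `Dᶜ` grows by at most `‖φ (ℓ t) - φ u‖`. So
  -- Koebe yields a linear differential inequality, and Gronwall gives `(exp (48 A) - 1) d`.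
  have key := norm_le_gronwallBound_of_norm_deriv_right_le (f := fun t => φ (ℓ t) - φ u)
    (f' := fun t => deriv φ (ℓ t) * (v - u)) (δ := 0) (K := 48 * A) (ε := 48 * A * d) (a := 0)
    (b := 1) (fun t ht => (hqd t ht).continuousAt.continuousWithinAt)
    (fun t ht => (hqd t (Ico_subset_Icc_self ht)).hasDerivWithinAt) (by simp [hℓ])
    (fun t ht => by
      have ht' := Ico_subset_Icc_self ht
      have h1 := hℓn t ht'
      have h2 := hφ.norm_deriv_le hne (u := ℓ t) (by linarith)
      have h3 : h * ‖deriv φ (ℓ t)‖ ≤ (1 - ‖ℓ t‖) * ‖deriv φ (ℓ t)‖ := by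
        gcongr; linarith
      have h4 := infDist_le_add_norm D (φ u) (φ (ℓ t))
      rw [norm_mul]
      calc ‖deriv φ (ℓ t)‖ * ‖v - u‖ ≤ ‖deriv φ (ℓ t)‖ * (A * h) := by gcongr
        _ = A * (h * ‖deriv φ (ℓ t)‖) := by ring
        _ ≤ A * (48 * (d + ‖φ (ℓ t) - φ u‖)) := by
            refine mul_le_mul_of_nonneg_left ?_ hA.le
            linarith
        _ = _ := by ring) 1 ⟨zero_le_one, le_rfl⟩
  rw [gronwallBound_of_K_ne_0 (by positivity)] at key
  have e1 : ℓ 1 = v := by simp [hℓ]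
  have e2 : 48 * A * d / (48 * A) = d := by field_simp
  rw [e1, e2] at key
  simp only [zero_mul, zero_add, sub_zero, mul_one] at key
  linarith

/-- The part of `D` that is close to `φ u` is the image of a Whitney neighbourhood of `u`. -/
theorem IsConformalOnto.norm_sub_le_of_near (hφ : IsConformalOnto φ D) {u v : ℂ} (hu : ‖u‖ < 1)
    (hv : ‖v‖ < 1) (hd : 0 < infDist (φ u) Dᶜ)
    (huv : 3 * ‖φ v - φ u‖ < infDist (φ u) Dᶜ) : ‖v - u‖ ≤ 1 - ‖u‖ := by
  set d := infDist (φ u) Dᶜ with hdd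
  obtain ⟨g, hg, hgm, hgl, -⟩ := hφ.exists_inverse
  have hb := ball_infDist_compl_subset D (φ u)
  have hdiff : DifferentiableOn ℂ (fun y => mob u (g y)) (ball (φ u) d) :=
    (differentiableOn_mob hu).comp (hg.mono hb) (hgm.mono_left hb)
  have hm : MapsTo (fun y => mob u (g y)) (ball (φ u) d)
      (closedBall (mob u (g (φ u))) 1) := fun y hy => by
    rw [hgl u hu, mob_self]
    exact ball_subset_closedBall (mapsTo_mob hu (hgm (hb hy)))
  have h := Complex.dist_le_div_mul_dist_of_mapsTo_ball hdiff hm (z := φ v) (by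
    rw [mem_ball, dist_eq_norm]; linarith [norm_nonneg (φ v - φ u)])
  rw [hgl u hu, hgl v hv, mob_self, dist_zero_right, dist_eq_norm] at h
  -- Schwarz's lemma for `mob u ∘ φ⁻¹` on the disk of radius `d` about `φ u`. A pseudohyperbolic
  -- distance of at most `1 / 3` then gives `(3 - ‖u‖) ‖v - u‖ ≤ 1 - ‖u‖ ^ 2`.
  have h1 : ‖mob u v‖ ≤ 1 / 3 := by
    refine h.trans ?_
    rw [one_div_mul_eq_div, div_le_div_iff₀ hd (by norm_num)]
    linarith
  have hne := norm_pos_iff.2 (one_sub_conj_mul_ne_zero hu hv)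
  rw [mob, norm_div, div_le_iff₀ hne] at h1
  have h2 : 1 - conj u * v = ((1 - ‖u‖ ^ 2 : ℝ) : ℂ) - conj u * (v - u) := by
    push_cast
    rw [← Complex.conj_mul']
    ring
  have h3 : ‖1 - conj u * v‖ ≤ (1 - ‖u‖ ^ 2) + ‖u‖ * ‖v - u‖ := by
    rw [h2]
    refine (norm_sub_le _ _).trans ?_
    rw [norm_mul, Complex.norm_conj, Complex.norm_real,
      Real.norm_of_nonneg (one_sub_norm_sq_pos hu).le]
  nlinarith [norm_nonneg u, norm_nonneg (v - u)]

end

/-! ### Packing by area and Whitney squares -/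

open MeasureTheory in
/-- The number of disjoint disks of radius `ρ` in a disk of radius `R`. -/
theorem card_mul_sq_le_of_disjoint_balls {ι : Type*} (s : Finset ι) (c : ι → ℂ) (x : ℂ) {ρ R : ℝ}
    (hρ : 0 ≤ ρ) (hR : 0 ≤ R)
    (hdisj : (s : Set ι).Pairwise fun i j => Disjoint (ball (c i) ρ) (ball (c j) ρ))
    (hsub : ∀ i ∈ s, ball (c i) ρ ⊆ closedBall x R) : (s.card : ℝ) * ρ ^ 2 ≤ R ^ 2 := by
  have h1 : volume (⋃ i ∈ s, ball (c i) ρ) = ∑ i ∈ s, volume (ball (c i) ρ) :=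
    measure_biUnion_finset hdisj fun _ _ => measurableSet_ball
  have h2 : volume (⋃ i ∈ s, ball (c i) ρ) ≤ volume (closedBall x R) :=
    measure_mono (iUnion₂_subset hsub)
  rw [h1] at h2
  simp only [Complex.volume_ball, Complex.volume_closedBall, Finset.sum_const, nsmul_eq_mul] at h2
  rw [← mul_assoc] at h2
  have hπ : ((NNReal.pi : ℝ≥0) : ℝ≥0∞) ≠ 0 := by
    simpa using NNReal.pi_ne_zero
  have h3 := (ENNReal.mul_le_mul_iff_left hπ ENNReal.coe_ne_top).1 h2
  rw [← ENNReal.ofReal_pow hρ, ← ENNReal.ofReal_pow hR, ← ENNReal.ofReal_natCast,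
    ← ENNReal.ofReal_mul (by positivity), ENNReal.ofReal_le_ofReal_iff (by positivity)] at h3
  exact h3

/-- A uniform bound on finite subfamilies yields finiteness as well, so the counting below can be
done on a `Finset`. -/
theorem finite_and_ncard_le_of_forall_finset {α : Type*} {S : Set α} {B : ℝ}
    (h : ∀ F : Finset α, (F : Set α) ⊆ S → (F.card : ℝ) ≤ B) :
    S.Finite ∧ (S.ncard : ℝ) ≤ B := by
  have hfin : S.Finite := by
    by_contra hinf
    obtain ⟨F, hF, hc⟩ := Set.Infinite.exists_subset_card_eq hinf (⌊B⌋₊ + 1)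
    have h1 := h F hF
    rw [hc] at h1
    push_cast at h1
    linarith [Nat.lt_floor_add_one B]
  refine ⟨hfin, ?_⟩
  have := h hfin.toFinset (by simp)
  rwa [← Set.ncard_eq_toFinset_card S hfin] at this

namespace Square

theorem norm_sub_le (Q : Square) {p q : ℂ} (hp : p ∈ Q.carrier) (hq : q ∈ Q.carrier) :
    ‖p - q‖ ≤ 2 * Q.len := by
  refine (Complex.norm_le_abs_re_add_abs_im _).trans ?_
  have h1 := abs_sub_le p.re Q.cen.re q.re
  have h2 := abs_sub_le p.im Q.cen.im q.im
  rw [abs_sub_comm Q.cen.re] at h1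
  rw [abs_sub_comm Q.cen.im] at h2
  rw [Complex.sub_re, Complex.sub_im]
  linarith [hp.1, hp.2, hq.1, hq.2]

theorem ball_subset_carrier (Q : Square) : ball Q.cen (Q.len / 2) ⊆ Q.carrier := by
  intro p hp
  rw [mem_ball, dist_eq_norm] at hp
  have h1 := Complex.abs_re_le_norm (p - Q.cen)
  have h2 := Complex.abs_im_le_norm (p - Q.cen)
  rw [Complex.sub_re] at h1
  rw [Complex.sub_im] at h2
  exact ⟨h1.trans hp.le, h2.trans hp.le⟩

theorem ball_subset_interior (Q : Square) : ball Q.cen (Q.len / 2) ⊆ interior Q.carrier :=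
  interior_maximal Q.ball_subset_carrier isOpen_ball

theorem isBounded_carrier (Q : Square) : Bornology.IsBounded Q.carrier :=
  isBounded_iff.2 ⟨2 * Q.len, fun p hp q hq => by
    rw [dist_eq_norm]; exact Q.norm_sub_le hp hq⟩

theorem diam_le (Q : Square) : diam Q.carrier ≤ 2 * Q.len :=
  diam_le_of_forall_dist_le (by linarith [Q.len_pos]) fun p hp q hq => by
    rw [dist_eq_norm]; exact Q.norm_sub_le hp hq

theorem len_le_diam (Q : Square) : Q.len ≤ diam Q.carrier := by
  have hl := Q.len_pos
  have h1 : Q.cen + ((Q.len / 2 : ℝ) : ℂ) ∈ Q.carrier := by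
    simp [carrier, abs_of_pos (half_pos hl), (half_pos hl).le]
  have h2 : Q.cen - ((Q.len / 2 : ℝ) : ℂ) ∈ Q.carrier := by
    simp [carrier, abs_of_pos (half_pos hl), (half_pos hl).le]
  have h3 := dist_le_diam_of_mem Q.isBounded_carrier h1 h2
  rw [dist_eq_norm, show Q.cen + ((Q.len / 2 : ℝ) : ℂ) - (Q.cen - ((Q.len / 2 : ℝ) : ℂ)) =
    ((Q.len : ℝ) : ℂ) by push_cast; ring, Complex.norm_real, Real.norm_of_nonneg hl.le] at h3
  exact h3

end Square


section

variable {D : Set ℂ} {𝒲 : Set Square}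

theorem IsWhitneyDecomposition.carrier_subset (h𝒲 : IsWhitneyDecomposition D 𝒲) {Q : Square}
    (hQ : Q ∈ 𝒲) : Q.carrier ⊆ D := by
  rw [← h𝒲.iUnion_eq]
  exact subset_biUnion_of_mem (u := fun Q : Square => Q.carrier) hQ

theorem IsWhitneyDecomposition.len_le_infDist (h𝒲 : IsWhitneyDecomposition D 𝒲) (hD : IsOpen D)
    (hne : (frontier D).Nonempty) {Q : Square} (hQ : Q ∈ 𝒲) {p : ℂ} (hp : p ∈ Q.carrier) :
    Q.len ≤ infDist p Dᶜ := by
  rw [← infDist_frontier_eq hD (h𝒲.carrier_subset hQ hp) hne]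
  exact Q.len_le_diam.trans (h𝒲.diam_le Q hQ p hp)

theorem IsWhitneyDecomposition.infDist_le_len (h𝒲 : IsWhitneyDecomposition D 𝒲) (hD : IsOpen D)
    (hne : (frontier D).Nonempty) {Q : Square} (hQ : Q ∈ 𝒲) {p : ℂ} (hp : p ∈ Q.carrier) :
    infDist p Dᶜ ≤ 10 * Q.len := by
  rw [← infDist_frontier_eq hD (h𝒲.carrier_subset hQ hp) hne]
  obtain ⟨q, hq, hqd⟩ := h𝒲.le_diam Q hQ
  have h1 : infDist p (frontier D) ≤ infDist q (frontier D) + dist p q :=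
    infDist_le_infDist_add_dist
  rw [dist_eq_norm] at h1
  linarith [Q.norm_sub_le hp hq, Q.diam_le]

/-- Squares of side length `s` in a Whitney decomposition that are contained in a disk. -/
theorem IsWhitneyDecomposition.card_mul_sq_le (h𝒲 : IsWhitneyDecomposition D 𝒲) {F : Finset Square}
    {s R : ℝ} (hs : 0 < s) (hR : 0 ≤ R) {x : ℂ} (hF : ∀ Q ∈ F, Q ∈ 𝒲 ∧ Q.len = s)
    (hsub : ∀ Q ∈ F, Q.carrier ⊆ closedBall x R) : (F.card : ℝ) * s ^ 2 ≤ 4 * R ^ 2 := by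
  have h := card_mul_sq_le_of_disjoint_balls F Square.cen x (ρ := s / 2) (by positivity) hR
    (fun Q hQ Q' hQ' hne => (h𝒲.disjoint (hF Q hQ).1 (hF Q' hQ').1 hne).mono
      (by rw [← (hF Q hQ).2]; exact Q.ball_subset_interior)
      (by rw [← (hF Q' hQ').2]; exact Q'.ball_subset_interior))
    (fun Q hQ => by
      rw [← (hF Q hQ).2]; exact Q.ball_subset_carrier.trans (hsub Q hQ))
  linarith

end

/-- A maximal separated subset of a finite family of points. -/
theorem exists_separated_subset {ι : Type*} [DecidableEq ι] (F : Finset ι) (ζ : ι → ℂ) (τ : ℝ) :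
    ∃ G ⊆ F, (∀ i ∈ G, ∀ j ∈ G, i ≠ j → τ ≤ ‖ζ i - ζ j‖) ∧
      ∀ i ∈ F, i ∈ G ∨ ∃ j ∈ G, ‖ζ i - ζ j‖ < τ := by
  induction F using Finset.induction_on with
  | empty => exact ⟨∅, by simp, by simp, by simp⟩
  | insert a F ha ih =>
    obtain ⟨G, hGF, hsep, hcov⟩ := ih
    by_cases h : ∃ j ∈ G, ‖ζ a - ζ j‖ < τ
    · refine ⟨G, hGF.trans (Finset.subset_insert a F), hsep, fun i hi => ?_⟩
      rcases Finset.mem_insert.1 hi with rfl | hi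
      · exact Or.inr h
      · exact hcov i hi
    · push Not at h
      refine ⟨insert a G, Finset.insert_subset_insert a hGF, fun i hi j hj hij => ?_,
        fun i hi => ?_⟩
      · rcases Finset.mem_insert.1 hi with hia | hiG <;> rcases Finset.mem_insert.1 hj with hja | hjG
        · exact absurd (hia.trans hja.symm) hij
        · rw [hia]; exact h j hjG
        · rw [hja, norm_sub_rev]; exact h i hiG
        · exact hsep i hiG j hjG hij
      · rcases Finset.mem_insert.1 hi with rfl | hi
        · exact Or.inl (Finset.mem_insert_self _ _)
        · rcases hcov i hi with h1 | ⟨j, hj, hlt⟩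
          · exact Or.inl (Finset.mem_insert_of_mem h1)
          · exact Or.inr ⟨j, Finset.mem_insert_of_mem hj, hlt⟩

/-! ### Dyadic points on radii and the Hölder condition -/

section

variable {φ : ℂ → ℂ} {D X : Set ℂ} {𝒲 : Set Square}

/-- The Hölder condition along a radius that ends in the preimage of `X`. -/
theorem norm_sub_le_of_holderOnWith {δ : ℝ} {C β : ℝ≥0}
    (hH : HolderOnWith C β φ (boundaryNhd φ X δ)) {ζ w : ℂ} (hζ : ζ ∈ sphere (0 : ℂ) 1)
    (hw : w ∈ X) (hlim : Tendsto (fun r : ℝ => φ (r * ζ)) (𝓝[<] 1) (𝓝 w)) {t : ℝ}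
    (ht0 : 0 ≤ t) (ht1 : t < 1) (htδ : 1 - t < δ) :
    ‖φ (t * ζ) - w‖ ≤ C * (1 - t) ^ (β : ℝ) := by
  have hζn : ‖ζ‖ = 1 := mem_sphere_zero_iff_norm.1 hζ
  have hmem : ∀ r : ℝ, t ≤ r → r < 1 → (r : ℂ) * ζ ∈ boundaryNhd φ X δ := fun r hr hr1 => by
    refine ⟨?_, mem_thickening_iff.2 ⟨ζ, ⟨hζ, w, hw, hlim⟩, ?_⟩⟩
    · rw [unitDisk, mem_ball_zero_iff, norm_mul, hζn, mul_one, Complex.norm_real,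
        Real.norm_of_nonneg (ht0.trans hr)]
      exact hr1
    · rw [dist_eq_norm, show (r : ℂ) * ζ - ζ = ((r - 1 : ℝ) : ℂ) * ζ by push_cast; ring,
        norm_mul, hζn, mul_one, Complex.norm_real, Real.norm_eq_abs, abs_sub_comm,
        abs_of_pos (by linarith)]
      linarith
  have hlim2 : Tendsto (fun r : ℝ => ‖φ (t * ζ) - φ (r * ζ)‖) (𝓝[<] 1) (𝓝 ‖φ (t * ζ) - w‖) :=
    (tendsto_const_nhds.sub hlim).norm
  refine le_of_tendsto hlim2 ?_
  filter_upwards [Ioo_mem_nhdsLT ht1] with r hr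
  rw [← dist_eq_norm]
  refine (hH.dist_le (hmem t le_rfl ht1) (hmem r hr.1.le hr.2)).trans ?_
  refine mul_le_mul_of_nonneg_left (Real.rpow_le_rpow dist_nonneg ?_ β.coe_nonneg) C.coe_nonneg
  rw [dist_eq_norm, ← sub_mul, norm_mul, hζn, mul_one, ← Complex.ofReal_sub, Complex.norm_real,
    Real.norm_eq_abs, abs_sub_comm, abs_of_pos (sub_pos.2 hr.1)]
  linarith [hr.2]

/-- The `k`-th dyadic point of the radius that ends in `ζ`. -/
def radialPt (ζ : ℂ) (k : ℕ) : ℂ := ((1 - (1 / 2 : ℝ) ^ k : ℝ) : ℂ) * ζ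

theorem half_pow_pos (k : ℕ) : (0 : ℝ) < (1 / 2) ^ k := by positivity

theorem half_pow_le_one (k : ℕ) : ((1 : ℝ) / 2) ^ k ≤ 1 := pow_le_one₀ (by norm_num) (by norm_num)

theorem norm_radialPt {ζ : ℂ} (hζ : ‖ζ‖ = 1) (k : ℕ) : ‖radialPt ζ k‖ = 1 - (1 / 2) ^ k := by
  rw [radialPt, norm_mul, hζ, mul_one, Complex.norm_real,
    Real.norm_of_nonneg (sub_nonneg.2 (half_pow_le_one k))]

theorem norm_radialPt_lt_one {ζ : ℂ} (hζ : ‖ζ‖ = 1) (k : ℕ) : ‖radialPt ζ k‖ < 1 := by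
  rw [norm_radialPt hζ]; linarith [half_pow_pos k]

theorem norm_radialPt_sub {ζ : ℂ} (hζ : ‖ζ‖ = 1) (k : ℕ) :
    ‖radialPt ζ k - ζ‖ = (1 / 2) ^ k := by
  rw [radialPt, show ((1 - (1 / 2 : ℝ) ^ k : ℝ) : ℂ) * ζ - ζ = ((-(1 / 2 : ℝ) ^ k : ℝ) : ℂ) * ζ by
    push_cast; ring, norm_mul, hζ, mul_one, Complex.norm_real, norm_neg,
    Real.norm_of_nonneg (half_pow_pos k).le]

theorem norm_radialPt_succ_sub {ζ : ℂ} (hζ : ‖ζ‖ = 1) (k : ℕ) :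
    ‖radialPt ζ (k + 1) - radialPt ζ k‖ = (1 / 2) ^ (k + 1) := by
  rw [radialPt, radialPt, ← sub_mul, ← Complex.ofReal_sub, norm_mul, hζ, mul_one,
    Complex.norm_real, show 1 - (1 / 2 : ℝ) ^ (k + 1) - (1 - (1 / 2) ^ k) = (1 / 2) ^ (k + 1) by ring,
    Real.norm_of_nonneg (half_pow_pos _).le]

/-- Consecutive dyadic points are `2^(-(k+1))` apart and at least that far from the circle. The
bound by the earlier point controls the sum of the steps; the one by the later point allows a step
backwards. -/
theorem IsConformalOnto.norm_radialPt_succ_sub_le (hφ : IsConformalOnto φ D) (hne : Dᶜ.Nonempty)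
    {ζ : ℂ} (hζ : ‖ζ‖ = 1) (k : ℕ) :
    ‖φ (radialPt ζ (k + 1)) - φ (radialPt ζ k)‖ ≤
        Real.exp 48 * infDist (φ (radialPt ζ k)) Dᶜ ∧
      ‖φ (radialPt ζ (k + 1)) - φ (radialPt ζ k)‖ ≤
        Real.exp 48 * infDist (φ (radialPt ζ (k + 1))) Dᶜ := by
  have h1 : ‖radialPt ζ k‖ ≤ 1 - (1 / 2) ^ (k + 1) := by
    rw [norm_radialPt hζ, pow_succ]; linarith [half_pow_pos k]
  have h2 : ‖radialPt ζ (k + 1)‖ ≤ 1 - (1 / 2) ^ (k + 1) := (norm_radialPt hζ _).le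
  have h3 := norm_radialPt_succ_sub hζ k
  have e : (48 : ℝ) = 48 * 1 := by norm_num
  refine ⟨?_, ?_⟩
  · rw [e]
    exact hφ.norm_sub_le_exp hne (half_pow_pos (k + 1)) one_pos h1 h2 (by rw [h3, one_mul])
  · rw [e, norm_sub_rev]
    exact hφ.norm_sub_le_exp hne (half_pow_pos (k + 1)) one_pos h2 h1
      (by rw [norm_sub_rev, h3, one_mul])

/-- On its way to a boundary point `w`, the image of a radius contains a point at distance at most
`s` from `w` that is comparatively far from the boundary. -/
theorem exists_radialPt_far (hφ : IsConformalOnto φ D) (hne : Dᶜ.Nonempty) {ζ w : ℂ}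
    (hζ : ‖ζ‖ = 1) (hw : w ∈ Dᶜ) {c s : ℝ} (hs : 0 < s) (hc : c = 1 / (1 + Real.exp 48)) {n K : ℕ}
    (hfar : c * s ≤ infDist (φ (radialPt ζ n)) Dᶜ) (hnK : n ≤ K)
    (hend : ‖φ (radialPt ζ K) - w‖ ≤ c * s / 2) :
    ∃ k, n ≤ k ∧ ‖φ (radialPt ζ k) - w‖ ≤ s ∧
      c * s / (2 * Real.exp 48 * K) ≤ infDist (φ (radialPt ζ k)) Dᶜ := by
  set E := Real.exp 48 with hE
  have hEp : 0 < E := Real.exp_pos _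
  have hcp : 0 < c := by rw [hc]; positivity
  have hcs : 0 < c * s := mul_pos hcp hs
  have hdw : ∀ k, infDist (φ (radialPt ζ k)) Dᶜ ≤ ‖φ (radialPt ζ k) - w‖ := fun k => by
    rw [← dist_eq_norm]; exact infDist_le_dist_of_mem hw
  set P : ℕ → Prop := fun k => c * s ≤ ‖φ (radialPt ζ k) - w‖ with hP
  classical
  -- `k₀` is the last index up to `K` at which the image is still `c s` away from `w`. The choice
  -- `(1 + E) c = 1` makes even this point at most `s` away, as one step back from the next shows.
  set k₀ := Nat.findGreatest P K with hk₀
  have hPn : P n := hfar.trans (hdw n)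
  have hnk : n ≤ k₀ := Nat.le_findGreatest hnK hPn
  have hPk : P k₀ := Nat.findGreatest_spec hnK hPn
  have hgt : ∀ k, k₀ < k → k ≤ K → ‖φ (radialPt ζ k) - w‖ < c * s := fun k h1 h2 =>
    not_le.1 (Nat.findGreatest_is_greatest h1 h2)
  have hkK : k₀ < K := by
    refine lt_of_le_of_ne (Nat.findGreatest_le K) fun h => ?_
    rw [h] at hPk
    exact absurd (hPk.trans hend) (by linarith)
  have hclose : ∀ k, k₀ ≤ k → k < K → ‖φ (radialPt ζ k) - w‖ ≤ s := by
    have hc1 : (1 + E) * c = 1 := by rw [hc]; field_simp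
    intro k h1 h2
    rcases h1.eq_or_lt with rfl | h1
    · have h3 := hgt (k₀ + 1) (Nat.lt_succ_self _) hkK
      have h4 := (hφ.norm_radialPt_succ_sub_le hne hζ k₀).2
      have h5 : ‖φ (radialPt ζ k₀) - w‖ ≤ ‖φ (radialPt ζ (k₀ + 1)) - φ (radialPt ζ k₀)‖ +
          ‖φ (radialPt ζ (k₀ + 1)) - w‖ := by
        rw [norm_sub_rev (φ (radialPt ζ (k₀ + 1)))]
        exact norm_sub_le_norm_sub_add_norm_sub _ _ _
      calc ‖φ (radialPt ζ k₀) - w‖ ≤ E * (c * s) + c * s := by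
            refine h5.trans (add_le_add (h4.trans ?_) h3.le)
            exact mul_le_mul_of_nonneg_left ((hdw _).trans h3.le) hEp.le
        _ = ((1 + E) * c) * s := by ring
        _ = s := by rw [hc1, one_mul]
    · refine (hgt k h1 h2.le).le.trans ?_
      have : c ≤ 1 := by nlinarith
      nlinarith
  have hKp : (0 : ℝ) < K := by exact_mod_cast (Nat.zero_le _).trans_lt hkK
  -- If all points from `k₀` to `K` were too near the boundary, each step would be shorter than `c s
  -- / (2 K)` and the path shorter than `c s / 2`, too short to get from `c s` to `c s / 2` away
  -- from `w`.
  by_contra! hcon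
  have hsmall : ∀ k ∈ Finset.Ico k₀ K, dist (φ (radialPt ζ k)) (φ (radialPt ζ (k + 1))) <
      c * s / (2 * K) := fun k hk => by
    obtain ⟨h1, h2⟩ := Finset.mem_Ico.1 hk
    rw [dist_comm, dist_eq_norm]
    refine (hφ.norm_radialPt_succ_sub_le hne hζ k).1.trans_lt ?_
    have := mul_lt_mul_of_pos_left (hcon k (hnk.trans h1) (hclose k h1 h2)) hEp
    refine this.trans_le (le_of_eq ?_)
    field_simp
  have hsum := dist_le_Ico_sum_dist (fun k => φ (radialPt ζ k)) hkK.le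
  have hlt := Finset.sum_lt_sum_of_nonempty (Finset.nonempty_Ico.2 hkK) hsmall
  rw [Finset.sum_const, Nat.card_Ico, nsmul_eq_mul] at hlt
  have hle : ((K - k₀ : ℕ) : ℝ) * (c * s / (2 * K)) ≤ c * s / 2 := by
    have : ((K - k₀ : ℕ) : ℝ) ≤ K := by exact_mod_cast Nat.sub_le _ _
    calc ((K - k₀ : ℕ) : ℝ) * (c * s / (2 * K)) ≤ K * (c * s / (2 * K)) := by gcongr
      _ = c * s / 2 := by field_simp
  have htri : ‖φ (radialPt ζ k₀) - w‖ ≤ dist (φ (radialPt ζ k₀)) (φ (radialPt ζ K)) +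
      ‖φ (radialPt ζ K) - w‖ := by
    rw [dist_eq_norm]; exact norm_sub_le_norm_sub_add_norm_sub _ _ _
  have hPk' : c * s ≤ ‖φ (radialPt ζ k₀) - w‖ := hPk
  linarith

/-! ### Counting the squares that are hit -/

theorem card_le_card_mul_of_fibers {α β : Type*} [DecidableEq β] {s : Finset α} {t : Finset β}
    {f : α → β} (hf : ∀ a ∈ s, f a ∈ t) {M : ℝ}
    (hM : ∀ b ∈ t, ((s.filter fun a => f a = b).card : ℝ) ≤ M) :
    (s.card : ℝ) ≤ t.card * M := by
  rw [Finset.card_eq_sum_card_fiberwise hf, Nat.cast_sum, ← nsmul_eq_mul]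
  exact Finset.sum_le_card_nsmul t _ M hM

/-- Squares of side length `s` that are hit by radii at the same height, where the radii end close
to each other in `D`. -/
theorem card_le_of_common_height (hφ : IsConformalOnto φ D) (hD : IsOpen D)
    (hfr : (frontier D).Nonempty) (hne : Dᶜ.Nonempty) (h𝒲 : IsWhitneyDecomposition D 𝒲)
    {F : Finset Square} {s ρ : ℝ} (hs : 0 < s) (hρ : 0 < ρ) (hρs : ρ ≤ s) {x : ℂ} {n : ℕ}
    (ζ : Square → ℂ) (r : Square → ℝ) (w : Square → ℂ) (k : Square → ℕ)
    (hF : ∀ Q ∈ F, Q ∈ 𝒲 ∧ Q.len = s) (hζ : ∀ Q ∈ F, ‖ζ Q‖ = 1) (hr0 : ∀ Q ∈ F, 0 ≤ r Q)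
    (hr1 : ∀ Q ∈ F, (1 / 2 : ℝ) ^ (n + 1) < 1 - r Q) (hr2 : ∀ Q ∈ F, 1 - r Q ≤ (1 / 2 : ℝ) ^ n)
    (hQ : ∀ Q ∈ F, φ (r Q * ζ Q) ∈ Q.carrier) (hnk : ∀ Q ∈ F, n ≤ k Q)
    (hwx : ∀ Q ∈ F, ‖w Q - x‖ ≤ s) (hkw : ∀ Q ∈ F, ‖φ (radialPt (ζ Q) (k Q)) - w Q‖ ≤ s)
    (hkd : ∀ Q ∈ F, 3 * ρ ≤ infDist (φ (radialPt (ζ Q) (k Q))) Dᶜ) :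
    (F.card : ℝ) ≤ 9 * s ^ 2 / ρ ^ 2 * (4 * (10 * Real.exp 528 + 2) ^ 2) := by
  classical
  -- The disks below have preimages within `2 * 2^(-n)` of `ζ Q`; a separation of `5`, more than `2
  -- + 2`, makes them disjoint.
  obtain ⟨G, hGF, hsep, hcov⟩ := exists_separated_subset F ζ (5 * (1 / 2 : ℝ) ^ n)
  have hcov' : ∀ Q ∈ F, ∃ Q' ∈ G, ‖ζ Q - ζ Q'‖ < 5 * (1 / 2 : ℝ) ^ n := fun Q hQF => by
    rcases hcov Q hQF with h | h
    · exact ⟨Q, h, by rw [sub_self, norm_zero]; linarith [half_pow_pos n]⟩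
    · exact h
  choose! f hfG hfd using hcov'
  have hGcard : (G.card : ℝ) ≤ 9 * s ^ 2 / ρ ^ 2 := by
    obtain ⟨g, -, hgm, hgl, hgr⟩ := hφ.exists_inverse
    have hnear : ∀ Q ∈ G, ∀ p ∈ ball (φ (radialPt (ζ Q) (k Q))) ρ,
        ‖g p - ζ Q‖ ≤ 2 * (1 / 2 : ℝ) ^ n := fun Q hQG p hp => by
      have hQF := hGF hQG
      have hζ1 := hζ Q hQF
      have hu := norm_radialPt_lt_one hζ1 (k Q)
      have hdk := hkd Q hQF
      rw [mem_ball, dist_eq_norm] at hp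
      have hpD : p ∈ D := ball_infDist_compl_subset D (φ (radialPt (ζ Q) (k Q))) (by
        rw [mem_ball, dist_eq_norm]; linarith)
      have h1 := hφ.norm_sub_le_of_near hu (mem_ball_zero_iff.1 (hgm hpD)) (by linarith)
        (by rw [hgr p hpD]; linarith)
      rw [norm_radialPt hζ1, sub_sub_cancel] at h1
      have h2 : (1 / 2 : ℝ) ^ k Q ≤ (1 / 2) ^ n :=
        pow_le_pow_of_le_one (by norm_num) (by norm_num) (hnk Q hQF)
      have h3 := norm_sub_le_norm_sub_add_norm_sub (g p) (radialPt (ζ Q) (k Q)) (ζ Q)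
      rw [norm_radialPt_sub hζ1] at h3
      linarith
    have h := card_mul_sq_le_of_disjoint_balls G (fun Q => φ (radialPt (ζ Q) (k Q))) x hρ.le
      (R := 3 * s) (by positivity) (fun Q hQG Q' hQG' hne' => by
        refine Set.disjoint_left.2 fun p hp hp' => ?_
        have h1 := hnear Q hQG p hp
        have h2 := hnear Q' hQG' p hp'
        have h3 := hsep Q hQG Q' hQG' hne'
        have h4 := norm_sub_le_norm_sub_add_norm_sub (ζ Q) (g p) (ζ Q')
        rw [norm_sub_rev (ζ Q) (g p)] at h4
        linarith [half_pow_pos n])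
      (fun Q hQG p hp => by
        have hQF := hGF hQG
        rw [mem_ball, dist_eq_norm] at hp
        rw [mem_closedBall, dist_eq_norm]
        have h1 := norm_sub_le_norm_sub_add_norm_sub p (φ (radialPt (ζ Q) (k Q))) x
        have h2 := norm_sub_le_norm_sub_add_norm_sub (φ (radialPt (ζ Q) (k Q))) (w Q) x
        linarith [hwx Q hQF, hkw Q hQF])
    rw [le_div_iff₀ (by positivity)]
    linarith
  refine (card_le_card_mul_of_fibers hfG (M := 4 * (10 * Real.exp 528 + 2) ^ 2)
    fun Q' hQ' => ?_).trans (mul_le_mul_of_nonneg_right hGcard (by positivity))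
  have hQ'F := hGF hQ'
  have hrn : ∀ Q ∈ F, ‖(r Q : ℂ) * ζ Q‖ = r Q := fun Q hQF => by
    rw [norm_mul, hζ Q hQF, mul_one, Complex.norm_real, Real.norm_of_nonneg (hr0 Q hQF)]
  have h := h𝒲.card_mul_sq_le (F := F.filter fun Q => f Q = Q') hs
    (R := (10 * Real.exp 528 + 2) * s) (by positivity) (x := φ (r Q' * ζ Q'))
    (fun Q hQF => hF Q (Finset.mem_filter.1 hQF).1) (fun Q hQF p hp => by
      obtain ⟨hQF, hfQ⟩ := Finset.mem_filter.1 hQF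
      have hd := hfd Q hQF
      rw [hfQ] at hd
      -- In units of `2^(-(n+1))`, the radial difference contributes `1` and the angular one `10`;
      -- hence the exponent `48 * 11 = 528`.
      have h1 : ‖(r Q : ℂ) * ζ Q - r Q' * ζ Q'‖ ≤ 11 * (1 / 2 : ℝ) ^ (n + 1) := by
        have e : (r Q : ℂ) * ζ Q - r Q' * ζ Q' =
            ((r Q - r Q' : ℝ) : ℂ) * ζ Q + (r Q' : ℂ) * (ζ Q - ζ Q') := by push_cast; ring
        have hr' : r Q' ≤ 1 := by linarith [hr1 Q' hQ'F, half_pow_pos (n + 1)]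
        have hrr : |r Q - r Q'| ≤ (1 / 2 : ℝ) ^ (n + 1) := by
          rw [abs_le, pow_succ]
          constructor <;>
          linarith [hr1 Q hQF, hr2 Q hQF, hr1 Q' hQ'F, hr2 Q' hQ'F, pow_succ (1 / 2 : ℝ) n]
        rw [e]
        refine (norm_add_le _ _).trans ?_
        rw [norm_mul, norm_mul, hζ Q hQF, mul_one, Complex.norm_real, Complex.norm_real,
          Real.norm_eq_abs, Real.norm_of_nonneg (hr0 Q' hQ'F)]
        have : r Q' * ‖ζ Q - ζ Q'‖ ≤ 1 * (5 * (1 / 2 : ℝ) ^ n) :=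
          mul_le_mul hr' hd.le (norm_nonneg _) zero_le_one
        linarith [pow_succ (1 / 2 : ℝ) n]
      have h2 := hφ.norm_sub_le_exp hne (half_pow_pos (n + 1)) (A := 11) (by norm_num)
        (u := r Q' * ζ Q') (v := r Q * ζ Q) (by rw [hrn Q' hQ'F]; linarith [hr1 Q' hQ'F])
        (by rw [hrn Q hQF]; linarith [hr1 Q hQF]) h1
      have h3 := h𝒲.infDist_le_len hD hfr (hF Q' hQ'F).1 (hQ Q' hQ'F)
      rw [(hF Q' hQ'F).2] at h3
      have h4 := Q.norm_sub_le hp (hQ Q hQF)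
      rw [(hF Q hQF).2] at h4
      have h5 := norm_sub_le_norm_sub_add_norm_sub p (φ (r Q * ζ Q)) (φ (r Q' * ζ Q'))
      have h6 := mul_le_mul_of_nonneg_left h3 (Real.exp_pos (48 * 11)).le
      rw [show (48 : ℝ) * 11 = 528 by norm_num] at h2 h6
      rw [mem_closedBall, dist_eq_norm]
      linarith)
  rw [mul_pow, ← mul_assoc] at h
  exact le_of_mul_le_mul_right h (by positivity)

/-- The data attached to a small square that is hit by a geodesic to `X`. -/
theorem exists_radial_data (hφ : IsConformalOnto φ D) {z : ℂ} (hφ0 : φ 0 = z) (hD : IsOpen D)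
    (hfr : (frontier D).Nonempty) (hne : Dᶜ.Nonempty) (hX : X ⊆ Dᶜ)
    (h𝒲 : IsWhitneyDecomposition D 𝒲) {δ : ℝ} {C β : ℝ≥0}
    (hH : HolderOnWith C β φ (boundaryNhd φ X δ)) {m s c : ℝ}
    (hm : ∀ u : ℂ, ‖u‖ ≤ 1 - δ / 2 → m ≤ infDist (φ u) Dᶜ) (hsm : 10 * s < m)
    (hc : c = 1 / (1 + Real.exp 48)) {K : ℕ}
    (hK : ((C : ℝ) + 1) * ((1 / 2 : ℝ) ^ K) ^ (β : ℝ) ≤ c * s / 2) {j : ℤ} {Q : Square}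
    (hQ : Q ∈ hitSquares D z X 𝒲 j) (hQs : Q.len = s) :
    ∃ (ζ : ℂ) (r : ℝ) (w : ℂ) (n k : ℕ), ‖ζ‖ = 1 ∧ w ∈ X ∧ 0 ≤ r ∧
      (1 / 2 : ℝ) ^ (n + 1) < 1 - r ∧ 1 - r ≤ (1 / 2 : ℝ) ^ n ∧ φ (r * ζ) ∈ Q.carrier ∧ n ≤ K ∧
      n ≤ k ∧ ‖φ (radialPt ζ k) - w‖ ≤ s ∧
      c * s / (2 * Real.exp 48 * K) ≤ infDist (φ (radialPt ζ k)) Dᶜ := by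
  obtain ⟨hQ𝒲, -, w, hw, γ, hγ, p, ⟨t, rfl⟩, hp⟩ := hQ
  obtain ⟨ζ, hζ, hlim, hrad⟩ := hγ.exists_radius hφ hφ0
  obtain ⟨r, hr0, hr1, hγr⟩ := hrad t
  rw [hγr] at hp
  have hζn : ‖ζ‖ = 1 := mem_sphere_zero_iff_norm.1 hζ
  have hrn : ‖(r : ℂ) * ζ‖ = r := by
    rw [norm_mul, hζn, mul_one, Complex.norm_real, Real.norm_of_nonneg hr0]
  have hsp : 0 < s := hQs ▸ Q.len_pos
  have hcp : 0 < c := by rw [hc]; positivity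
  have hd1 := h𝒲.len_le_infDist hD hfr hQ𝒲 hp
  have hd2 := h𝒲.infDist_le_len hD hfr hQ𝒲 hp
  rw [hQs] at hd1 hd2
  -- A small square lies near the boundary, so `r` is close to `1`. The margin `δ / 2` is there
  -- because the dyadic point of height `n` may be up to twice as far from the circle.
  have hrδ : 1 - r < δ / 2 := by
    by_contra! h
    have := hm (r * ζ) (by rw [hrn]; linarith)
    linarith
  obtain ⟨n, hn1, hn2⟩ := exists_nat_pow_near_of_lt_one (sub_pos.2 hr1) (by linarith : 1 - r ≤ 1)
    (by norm_num : (0 : ℝ) < 1 / 2) (by norm_num)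
  have hnδ : (1 / 2 : ℝ) ^ n < δ := by
    rw [pow_succ] at hn1; linarith
  have hHk : ∀ k, n ≤ k → ‖φ (radialPt ζ k) - w‖ ≤ C * ((1 / 2 : ℝ) ^ k) ^ (β : ℝ) := fun k hk => by
    have hle : (1 / 2 : ℝ) ^ k ≤ (1 / 2) ^ n := pow_le_pow_of_le_one (by norm_num) (by norm_num) hk
    have h := norm_sub_le_of_holderOnWith hH hζ hw hlim (t := 1 - (1 / 2 : ℝ) ^ k)
      (sub_nonneg.2 (half_pow_le_one k)) (by linarith [half_pow_pos k]) (by linarith)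
    rwa [sub_sub_cancel] at h
  have hfar : c * s ≤ infDist (φ (radialPt ζ n)) Dᶜ := by
    have e : radialPt ζ n = ((1 - (1 / 2 : ℝ) ^ n : ℝ) : ℂ) * ζ := rfl
    have h1 := hφ.norm_sub_le_exp hne (half_pow_pos (n + 1)) one_pos (u := radialPt ζ n)
      (v := r * ζ) (by rw [norm_radialPt hζn, pow_succ]; linarith [half_pow_pos n])
      (by rw [hrn]; linarith) (by
        rw [e, ← sub_mul, ← Complex.ofReal_sub, norm_mul, hζn, mul_one, one_mul,
          Complex.norm_real, Real.norm_eq_abs, abs_le]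
        constructor <;> linarith [pow_succ (1 / 2 : ℝ) n])
    rw [mul_one] at h1
    have h2 := infDist_le_add_norm D (φ (radialPt ζ n)) (φ (r * ζ))
    rw [hc, one_div_mul_eq_div, div_le_iff₀ (by positivity)]
    linarith
  have hdw : ∀ k, infDist (φ (radialPt ζ k)) Dᶜ ≤ ‖φ (radialPt ζ k) - w‖ := fun k => by
    rw [← dist_eq_norm]; exact infDist_le_dist_of_mem (hX hw)
  have hcs : 0 < c * s := mul_pos hcp hsp
  -- Otherwise the Hölder bound would put the point of height `n` within `c s / 2` of `w`, against
  -- `hfar`.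
  have hnK : n ≤ K := by
    by_contra! h
    have h1 : ((1 / 2 : ℝ) ^ n) ^ (β : ℝ) ≤ ((1 / 2 : ℝ) ^ K) ^ (β : ℝ) :=
      Real.rpow_le_rpow (half_pow_pos n).le
        (pow_le_pow_of_le_one (by norm_num) (by norm_num) h.le) β.coe_nonneg
    have h2 := hHk n le_rfl
    have h3 : (C : ℝ) * ((1 / 2 : ℝ) ^ n) ^ (β : ℝ) ≤ (C + 1) * ((1 / 2 : ℝ) ^ K) ^ (β : ℝ) :=
      mul_le_mul (by linarith) h1 (Real.rpow_nonneg (half_pow_pos n).le _) (by positivity)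
    linarith [hdw n]
  obtain ⟨k, hk1, hk2, hk3⟩ := exists_radialPt_far hφ hne hζn (hX hw) hsp hc hfar hnK (by
    refine (hHk K hnK).trans (le_trans ?_ hK)
    refine mul_le_mul_of_nonneg_right (by linarith) (Real.rpow_nonneg (half_pow_pos K).le _))
  exact ⟨ζ, r, w, n, k, hζn, hw, hr0, hn1, hn2, hp, hnK, hk1, hk2, hk3⟩

theorem exists_pos_le_infDist_compl (hφ : IsConformalOnto φ D) (hD : IsOpen D)
    (hne : Dᶜ.Nonempty) {r : ℝ} (hr0 : 0 ≤ r) (hr : r < 1) :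
    ∃ m : ℝ, 0 < m ∧ ∀ u : ℂ, ‖u‖ ≤ r → m ≤ infDist (φ u) Dᶜ := by
  have hsub : closedBall (0 : ℂ) r ⊆ ball 0 1 := closedBall_subset_ball hr
  have hcont : ContinuousOn (fun u => infDist (φ u) Dᶜ) (closedBall (0 : ℂ) r) :=
    (continuous_infDist_pt _).comp_continuousOn (hφ.differentiableOn.continuousOn.mono hsub)
  obtain ⟨u₀, hu₀, hmin⟩ := (isCompact_closedBall (0 : ℂ) r).exists_isMinOn
    ⟨0, by simpa using hr0⟩ hcont
  refine ⟨_, (hD.isClosed_compl.notMem_iff_infDist_pos hne).1 fun h => h ?_, fun u hu =>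
    hmin (mem_closedBall_zero_iff.2 hu)⟩
  exact hφ.bijOn.mapsTo (hsub hu₀)

/-- Solving for `K` gives `K ≥ (j + log₂ (2 C' / c)) / β`, which is linear in `j`; `C' ≥ 1` and `c ≤
1` keep the logarithm nonnegative. -/
theorem exists_scale_bound {C' c β : ℝ} (hC : 1 ≤ C') (hc0 : 0 < c) (hc1 : c ≤ 1) (hβ : 0 < β) :
    ∃ A : ℝ, 0 < A ∧ ∀ j : ℕ, 1 ≤ j → ∃ K : ℕ, (K : ℝ) ≤ A * j ∧
      C' * ((1 / 2 : ℝ) ^ K) ^ β ≤ c * (1 / 2) ^ j / 2 := by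
  set b := Real.logb 2 (2 * C' / c) with hb
  have hq : 1 ≤ 2 * C' / c := by rw [le_div_iff₀ hc0]; linarith
  have hb0 : 0 ≤ b := Real.logb_nonneg (by norm_num) hq
  refine ⟨(1 + b) / β + 1, by positivity, fun j hj => ⟨⌈(j + b) / β⌉₊, ?_, ?_⟩⟩
  · have hj' : (1 : ℝ) ≤ j := by exact_mod_cast hj
    have h1 := (Nat.ceil_lt_add_one (show 0 ≤ (j + b) / β by positivity)).le
    refine h1.trans ?_
    rw [add_mul, div_mul_eq_mul_div, one_mul]
    refine add_le_add (div_le_div_of_nonneg_right ?_ hβ.le) hj'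
    nlinarith
  · set K := ⌈(j + b) / β⌉₊
    have h1 : (j + b) / β ≤ K := Nat.le_ceil _
    rw [div_le_iff₀ hβ] at h1
    have h2 : ((1 / 2 : ℝ) ^ K) ^ β ≤ (1 / 2) ^ j * (c / (2 * C')) := by
      calc ((1 / 2 : ℝ) ^ K) ^ β = (1 / 2 : ℝ) ^ ((K : ℝ) * β) := by
            rw [← Real.rpow_natCast, ← Real.rpow_mul (by norm_num)]
        _ ≤ (1 / 2 : ℝ) ^ ((j : ℝ) + b) :=
            Real.rpow_le_rpow_of_exponent_ge (by norm_num) (by norm_num) h1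
        _ = (1 / 2) ^ j * (c / (2 * C')) := by
            rw [Real.rpow_add (by norm_num), Real.rpow_natCast, one_div, Real.inv_rpow zero_le_two b,
              hb, Real.rpow_logb (by norm_num) (by norm_num) (by linarith), inv_div]
    calc C' * ((1 / 2 : ℝ) ^ K) ^ β ≤ C' * ((1 / 2) ^ j * (c / (2 * C'))) := by gcongr
      _ = c * (1 / 2) ^ j / 2 := by field_simp

theorem two_zpow_neg_natCast (j : ℕ) : (2 : ℝ) ^ (-(j : ℤ)) = (1 / 2) ^ j := by
  rw [zpow_neg, zpow_natCast, one_div, inv_pow]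

/-- The number of small squares that are hit is at most a polynomial in the generation times the
number of disks of the same size that cover `X`. -/
theorem exists_card_le_cover (hφ : IsConformalOnto φ D) {z : ℂ} (hφ0 : φ 0 = z) (hD : IsOpen D)
    (hfr : (frontier D).Nonempty) (hne : Dᶜ.Nonempty) (hX : X ⊆ Dᶜ) {δ : ℝ} (hδ0 : 0 < δ)
    (hδ1 : δ < 1) {C β : ℝ≥0} (hβ : 0 < β) (hH : HolderOnWith C β φ (boundaryNhd φ X δ)) :
    ∃ (A : ℝ) (j₀ : ℕ), 0 < A ∧ ∀ 𝒲, IsWhitneyDecomposition D 𝒲 → ∀ j : ℕ, j₀ ≤ j →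
      ∀ T : Finset ℂ, (∀ w ∈ X, ∃ x ∈ T, ‖w - x‖ ≤ (1 / 2) ^ j) →
      ∀ F : Finset Square, (F : Set Square) ⊆ hitSquares D z X 𝒲 j →
        (F.card : ℝ) ≤ A * (j : ℝ) ^ 3 * T.card := by
  obtain ⟨m, hm0, hm⟩ := exists_pos_le_infDist_compl hφ hD hne (r := 1 - δ / 2) (by linarith)
    (by linarith)
  set E := Real.exp 48 with hE
  have hEp : 0 < E := Real.exp_pos _
  have hE1 : 1 ≤ E := Real.one_le_exp (by norm_num)
  set c : ℝ := 1 / (1 + E) with hc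
  have hc0 : 0 < c := by positivity
  have hc1 : c ≤ 1 := by rw [hc, div_le_one (by positivity)]; linarith
  obtain ⟨A₁, hA₁, hK⟩ := exists_scale_bound (C' := (C : ℝ) + 1) (β := β)
    (by linarith [C.coe_nonneg]) hc0 hc1 (by exact_mod_cast hβ)
  obtain ⟨j₁, hj₁⟩ := exists_pow_lt_of_lt_one (show (0 : ℝ) < m / 10 by positivity)
    (show (1 / 2 : ℝ) < 1 by norm_num)
  set M : ℝ := 4 * (10 * Real.exp 528 + 2) ^ 2 with hM
  have hMp : 0 < M := by positivity
  refine ⟨(A₁ + 1) * (324 * E ^ 2 * A₁ ^ 2 / c ^ 2 * M), max j₁ 1, by positivity, ?_⟩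
  intro 𝒲 h𝒲 j hj T hT F hF
  have hj1 : 1 ≤ j := (le_max_right _ _).trans hj
  have hj1' : (1 : ℝ) ≤ j := by exact_mod_cast hj1
  obtain ⟨K, hKj, hKC⟩ := hK j hj1
  set s : ℝ := (1 / 2) ^ j with hs
  have hsp : 0 < s := half_pow_pos j
  have hsm : 10 * s < m := by
    have h1 : s ≤ (1 / 2) ^ j₁ :=
      pow_le_pow_of_le_one (by norm_num) (by norm_num) ((le_max_left _ _).trans hj)
    linarith
  have hlen : ∀ Q ∈ F, Q ∈ 𝒲 ∧ Q.len = s := fun Q hQ => by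
    obtain ⟨h1, h2, -⟩ := hF hQ
    exact ⟨h1, by rw [h2, two_zpow_neg_natCast]⟩
  have hdata : ∀ Q ∈ F, ∃ (ζ : ℂ) (r : ℝ) (w x : ℂ) (n k : ℕ), ‖ζ‖ = 1 ∧ 0 ≤ r ∧
      (1 / 2 : ℝ) ^ (n + 1) < 1 - r ∧ 1 - r ≤ (1 / 2 : ℝ) ^ n ∧ φ (r * ζ) ∈ Q.carrier ∧ n ≤ K ∧
      n ≤ k ∧ ‖φ (radialPt ζ k) - w‖ ≤ s ∧
      c * s / (2 * E * K) ≤ infDist (φ (radialPt ζ k)) Dᶜ ∧ x ∈ T ∧ ‖w - x‖ ≤ s := fun Q hQ => by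
    obtain ⟨ζ, r, w, n, k, h1, hw, h2, h3, h4, h5, h6, h7, h8, h9⟩ :=
      exists_radial_data hφ hφ0 hD hfr hne hX h𝒲 hH hm hsm hc hKC (hF hQ) (hlen Q hQ).2
    obtain ⟨x, hx, hwx⟩ := hT w hw
    exact ⟨ζ, r, w, x, n, k, h1, h2, h3, h4, h5, h6, h7, h8, h9, hx, hwx⟩
  choose! ζ r w x n k h1 h2 h3 h4 h5 h6 h7 h8 h9 h10 h11 using hdata
  have hKp : 0 < K := by
    rcases Nat.eq_zero_or_pos K with h | h
    · rw [h, pow_zero, Real.one_rpow, mul_one] at hKC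
      have : s ≤ 1 := half_pow_le_one j
      nlinarith [C.coe_nonneg]
    · exact h
  have hKp' : (0 : ℝ) < K := by exact_mod_cast hKp
  have hK1 : (1 : ℝ) ≤ K := by exact_mod_cast hKp
  -- One third of the distance to the boundary guaranteed at the chosen dyadic points. The number
  -- `324 = 9 * 36` in the constant is the resulting area ratio.
  set ρ : ℝ := c * s / (6 * E * K) with hρ
  have hρp : 0 < ρ := by positivity
  have hρs : ρ ≤ s := by
    rw [hρ, div_le_iff₀ (by positivity)]
    have : 1 ≤ E * K := one_le_mul_of_one_le_of_one_le hE1 hK1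
    nlinarith
  have h3ρ : 3 * ρ = c * s / (2 * E * K) := by rw [hρ]; field_simp; norm_num
  have hcount := card_le_card_mul_of_fibers (s := F) (t := Finset.range (K + 1) ×ˢ T)
    (f := fun Q => (n Q, x Q)) (fun Q hQ => Finset.mem_product.2
      ⟨Finset.mem_range.2 (Nat.lt_succ_of_le (h6 Q hQ)), h10 Q hQ⟩)
    (M := 9 * s ^ 2 / ρ ^ 2 * M) (by
      rintro ⟨n', x'⟩ -
      have hmem : ∀ Q ∈ F.filter fun Q => (n Q, x Q) = (n', x'), Q ∈ F ∧ n Q = n' ∧ x Q = x' :=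
        fun Q hQ => by simpa using hQ
      refine card_le_of_common_height hφ hD hfr hne h𝒲 hsp hρp hρs (x := x') (n := n') ζ r w k
        (fun Q hQ => hlen Q (hmem Q hQ).1) (fun Q hQ => h1 Q (hmem Q hQ).1)
        (fun Q hQ => h2 Q (hmem Q hQ).1) ?_ ?_ (fun Q hQ => h5 Q (hmem Q hQ).1) ?_ ?_
        (fun Q hQ => h8 Q (hmem Q hQ).1) (fun Q hQ => h3ρ ▸ h9 Q (hmem Q hQ).1) <;>
      intro Q hQ <;> obtain ⟨hQF, hn, hx⟩ := hmem Q hQ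
      · exact hn ▸ h3 Q hQF
      · exact hn ▸ h4 Q hQF
      · exact hn ▸ h7 Q hQF
      · exact hx ▸ h11 Q hQF)
  refine hcount.trans ?_
  have e : 9 * s ^ 2 / ρ ^ 2 = 324 * E ^ 2 * (K : ℝ) ^ 2 / c ^ 2 := by
    rw [hρ]; field_simp; norm_num
  rw [e, Finset.card_product, Finset.card_range]
  push_cast
  have hK1j : (K : ℝ) + 1 ≤ (A₁ + 1) * j := by linarith
  have hK2 : (K : ℝ) ^ 2 ≤ (A₁ * j) ^ 2 := pow_le_pow_left₀ hKp'.le hKj 2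
  calc ((K : ℝ) + 1) * T.card * (324 * E ^ 2 * (K : ℝ) ^ 2 / c ^ 2 * M)
      ≤ ((A₁ + 1) * j) * T.card * (324 * E ^ 2 * (A₁ * j) ^ 2 / c ^ 2 * M) := by gcongr
    _ = _ := by ring

/-! ### Minkowski dimension, polynomial factors and the area bound -/

/-- Covers of a set of given upper Minkowski dimension by dyadic disks. -/
theorem eventually_exists_cover {d d' : ℝ} (hdim : upperMinkowskiDim X ≤ (d : EReal))
    (hdd : d < d') : ∀ᶠ j : ℕ in atTop, ∃ T : Finset ℂ,
      (∀ w ∈ X, ∃ x ∈ T, ‖w - x‖ ≤ (1 / 2) ^ j) ∧ (T.card : ℝ) ≤ (2 : ℝ) ^ (d' * j) := by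
  have hev := eventually_lt_of_limsup_lt (hdim.trans_lt (EReal.coe_lt_coe_iff.2 hdd))
  have htend : Tendsto (fun j : ℕ => (1 / 2 : ℝ≥0) ^ j) atTop (𝓝[>] 0) := by
    refine tendsto_nhdsWithin_iff.2 ⟨?_, Eventually.of_forall fun j => ?_⟩
    · exact tendsto_pow_atTop_nhds_zero_of_lt_one (by simp) (by
        rw [← NNReal.coe_lt_coe]; norm_num)
    · exact mem_Ioi.2 (by positivity)
  filter_upwards [htend.eventually hev, eventually_ge_atTop 1] with j hj hj1
  have hco : (((1 / 2 : ℝ≥0) ^ j : ℝ≥0) : ℝ) = (1 / 2) ^ j := by push_cast; norm_num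
  have hj0 : (0 : ℝ) < j := by exact_mod_cast hj1
  have hL : Real.log (1 / (((1 / 2 : ℝ≥0) ^ j : ℝ≥0) : ℝ)) = j * Real.log 2 := by
    rw [hco, ← one_div_pow, one_div_one_div, Real.log_pow]
  have hLp : 0 < (j : ℝ) * Real.log 2 := mul_pos hj0 (Real.log_pos (by norm_num))
  rw [hL, EReal.div_lt_iff (by exact_mod_cast hLp) (EReal.coe_ne_top _), ← EReal.coe_mul] at hj
  have hpow : (d' * (j * Real.log 2) : ℝ) = Real.log ((2 : ℝ) ^ (d' * j)) := by
    rw [Real.log_rpow (by norm_num)]; ring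
  have h2p : (0 : ℝ) < (2 : ℝ) ^ (d' * j) := Real.rpow_pos_of_pos (by norm_num) _
  rw [hpow, ← ENNReal.log_ofReal_of_pos h2p, ENNReal.log_lt_log_iff] at hj
  have htop : coveringNumber ((1 / 2 : ℝ≥0) ^ j) X ≠ ⊤ := fun h => by
    rw [h] at hj
    simp at hj
  obtain ⟨T, -, hTf, hTc, hTe⟩ := exists_set_encard_eq_coveringNumber htop
  refine ⟨hTf.toFinset, fun w hw => ?_, ?_⟩
  · obtain ⟨x, hx, hwx⟩ := mem_iUnion₂.1 (isCover_iff_subset_iUnion_closedBall.1 hTc hw)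
    refine ⟨x, hTf.mem_toFinset.2 hx, ?_⟩
    rwa [mem_closedBall, dist_eq_norm, hco] at hwx
  · rw [← hTe, hTf.encard_eq_coe_toFinset_card, ENat.toENNReal_coe, ← ENNReal.ofReal_natCast] at hj
    exact ((ENNReal.ofReal_lt_ofReal_iff h2p).1 hj).le

theorem exists_pow_three_le {a : ℝ} (ha : 0 < a) :
    ∃ B : ℝ, 0 < B ∧ ∀ j : ℕ, (j : ℝ) ^ 3 ≤ B * (2 : ℝ) ^ (a * j) := by
  have hr : (2 : ℝ) ^ (-a) < 1 := Real.rpow_lt_one_of_one_lt_of_neg (by norm_num) (by linarith)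
  have hr0 : (0 : ℝ) < (2 : ℝ) ^ (-a) := Real.rpow_pos_of_pos (by norm_num) _
  have ht := tendsto_pow_const_mul_const_pow_of_abs_lt_one 3 (by rwa [abs_of_pos hr0])
  obtain ⟨B, hB⟩ := ht.bddAbove_range
  refine ⟨max B 1, lt_max_of_lt_right one_pos, fun j => ?_⟩
  have h1 : (j : ℝ) ^ 3 * ((2 : ℝ) ^ (-a)) ^ j ≤ B := hB ⟨j, rfl⟩
  have h2 : ((2 : ℝ) ^ (-a)) ^ j * (2 : ℝ) ^ (a * j) = 1 := by
    rw [← Real.rpow_natCast, ← Real.rpow_mul (by norm_num), ← Real.rpow_add (by norm_num)]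
    simp
  have h3 : (0 : ℝ) < (2 : ℝ) ^ (a * j) := Real.rpow_pos_of_pos (by norm_num) _
  calc (j : ℝ) ^ 3 = (j : ℝ) ^ 3 * ((2 : ℝ) ^ (-a)) ^ j * (2 : ℝ) ^ (a * j) := by
        rw [mul_assoc, h2, mul_one]
    _ ≤ B * (2 : ℝ) ^ (a * j) := by gcongr
    _ ≤ _ := by gcongr; exact le_max_left _ _

/-- A bound by area for the number of all Whitney squares of a given size. -/
theorem IsWhitneyDecomposition.card_le (h𝒲 : IsWhitneyDecomposition D 𝒲) {R : ℝ} (hR : 0 ≤ R)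
    (hDR : D ⊆ closedBall 0 R) {z : ℂ} {j : ℤ} {F : Finset Square}
    (hF : (F : Set Square) ⊆ hitSquares D z X 𝒲 j) :
    (F.card : ℝ) ≤ 4 * R ^ 2 * (2 : ℝ) ^ (2 * (j : ℝ)) := by
  have h2 : (0 : ℝ) < (2 : ℝ) ^ (-j) := by positivity
  have h := h𝒲.card_mul_sq_le (F := F) h2 hR (x := 0)
    (fun Q hQ => ⟨(hF hQ).1, (hF hQ).2.1⟩)
    (fun Q hQ => (h𝒲.carrier_subset (hF hQ).1).trans hDR)
  have e : ((2 : ℝ) ^ (-j)) ^ 2 * (2 : ℝ) ^ (2 * (j : ℝ)) = 1 := by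
    rw [← Real.rpow_intCast, ← Real.rpow_natCast, ← Real.rpow_mul (by norm_num),
      ← Real.rpow_add (by norm_num)]
    push_cast
    rw [show -(j : ℝ) * 2 + 2 * j = 0 by ring, Real.rpow_zero]
  calc (F.card : ℝ) = F.card * ((2 : ℝ) ^ (-j)) ^ 2 * (2 : ℝ) ^ (2 * (j : ℝ)) := by
        rw [mul_assoc, e, mul_one]
    _ ≤ _ := by gcongr

end

end WhitneyHyp

end

/-! ### Choice of the constant and conclusion -/

theorem lemma4p2 (D : Set ℂ) (hD : WhitneyHyp.IsBoundedJordanDomain D) (z : ℂ) (hz : z ∈ D)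
    (X : Set ℂ) (hXD : X ⊆ frontier D) (hX : IsClosed X)
    (φ : ℂ → ℂ) (hφ : WhitneyHyp.IsConformalOnto φ D) (hφ0 : φ 0 = z)
    (hφre : 0 < (deriv φ 0).re) (hφim : (deriv φ 0).im = 0)
    (β : ℝ≥0) (hβ0 : 0 < β) (hβ1 : β < 1) (δ : ℝ) (hδ0 : 0 < δ) (hδ1 : δ < 1)
    (hHolder : ∃ C : ℝ≥0, HolderOnWith C β φ (WhitneyHyp.boundaryNhd φ X δ))
    (a : ℝ) (ha : 0 < a) :
    ∃ c : ℝ, 0 < c ∧ ∀ d : ℝ, 0 < d → d < 2 → WhitneyHyp.upperMinkowskiDim X ≤ (d : EReal) →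
      ∀ 𝒲 : Set WhitneyHyp.Square, WhitneyHyp.IsWhitneyDecomposition D 𝒲 → ∀ j : ℤ,
        (WhitneyHyp.hitSquares D z X 𝒲 j).Finite ∧
        ((WhitneyHyp.hitSquares D z X 𝒲 j).ncard : ℝ) ≤ c * (2 : ℝ) ^ ((d + a) * (j : ℝ)) := by
  obtain ⟨C, hC⟩ := hHolder
  obtain ⟨R, hR0, hDR⟩ := hD.isBounded.subset_closedBall_lt 0 0
  have hDuniv : D ≠ univ := fun h => by
    have := hD.isBounded
    rw [h] at this
    exact NormedSpace.unbounded_univ ℝ ℂ this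
  have hne : Dᶜ.Nonempty := nonempty_compl.2 hDuniv
  have hfr : (frontier D).Nonempty := nonempty_frontier_iff.2 ⟨⟨z, hz⟩, hDuniv⟩
  have hXc : X ⊆ Dᶜ := fun x hx => by
    have := hXD hx
    rw [hD.isOpen.frontier_eq] at this
    exact this.2
  set S : Set ℝ := {d | 0 < d ∧ d < 2 ∧ WhitneyHyp.upperMinkowskiDim X ≤ (d : EReal)} with hS
  rcases S.eq_empty_or_nonempty with hSe | hSne
  · refine ⟨1, one_pos, fun d h0 h2 hd => ?_⟩
    exact absurd (show d ∈ S from ⟨h0, h2, hd⟩) (by simp [hSe])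
  -- `d₁` exceeds every admissible `d` by at most `a / 2`, so a cover adapted to `d₁` serves all of
  -- them. The rest of `a` is split into `a / 4` for the cover and `a / 4` for the factor `j ^ 3`.
  obtain ⟨d₁, hd₁, hd₁lt⟩ := Real.lt_sInf_add_pos hSne (half_pos ha)
  have hd₁le : ∀ d ∈ S, d₁ ≤ d + a / 2 := fun d hd => by
    have := csInf_le ⟨0, fun y hy => hy.1.le⟩ hd
    linarith
  obtain ⟨A, j₀, hA, hnear⟩ := WhitneyHyp.exists_card_le_cover hφ hφ0 hD.isOpen hfr hne hXc hδ0 hδ1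
    hβ0 hC
  obtain ⟨j₁, hcover⟩ := eventually_atTop.1 (WhitneyHyp.eventually_exists_cover hd₁.2.2
    (show d₁ < d₁ + a / 4 by linarith))
  obtain ⟨B, hB, hpoly⟩ := WhitneyHyp.exists_pow_three_le (show 0 < a / 4 by positivity)
  set J : ℕ := max j₀ j₁ with hJ
  obtain ⟨J', hJ'⟩ := pow_unbounded_of_one_lt (4 * R ^ 2) (show (1 : ℝ) < 2 by norm_num)
  have h2 : (1 : ℝ) ≤ 2 := one_le_two
  have h2p : (0 : ℝ) < 2 := two_pos
  set c₂ : ℝ := 4 * R ^ 2 * (2 : ℝ) ^ ((2 + a) * (J + J' : ℝ)) with hc₂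
  have hc₂p : 0 < c₂ := by positivity
  refine ⟨A * B + c₂, by positivity, fun d hd0 hd2 hdim 𝒲 h𝒲 j => ?_⟩
  refine WhitneyHyp.finite_and_ncard_le_of_forall_finset fun F hF => ?_
  have hpos : (0 : ℝ) < (2 : ℝ) ^ ((d + a) * (j : ℝ)) := Real.rpow_pos_of_pos h2p _
  rcases le_or_gt (J : ℤ) j with hj | hj
  · obtain ⟨n, rfl⟩ := Int.eq_ofNat_of_zero_le ((Int.natCast_nonneg J).trans hj)
    have hn : J ≤ n := by exact_mod_cast hj
    obtain ⟨T, hT, hTc⟩ := hcover n ((le_max_right _ _).trans hn)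
    have h := hnear 𝒲 h𝒲 n ((le_max_left _ _).trans hn) T hT F hF
    have hn0 : (0 : ℝ) ≤ n := n.cast_nonneg
    have hexp : (2 : ℝ) ^ (a / 4 * n) * (2 : ℝ) ^ ((d₁ + a / 4) * n) ≤
        (2 : ℝ) ^ ((d + a) * ((n : ℤ) : ℝ)) := by
      rw [← Real.rpow_add h2p, Int.cast_natCast]
      refine Real.rpow_le_rpow_of_exponent_le h2 ?_
      rw [← add_mul]
      exact mul_le_mul_of_nonneg_right (by linarith [hd₁le d ⟨hd0, hd2, hdim⟩]) hn0
    calc (F.card : ℝ) ≤ A * (n : ℝ) ^ 3 * T.card := h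
      _ ≤ A * (B * (2 : ℝ) ^ (a / 4 * n)) * (2 : ℝ) ^ ((d₁ + a / 4) * n) := by
          gcongr
          exact hpoly n
      _ = A * B * ((2 : ℝ) ^ (a / 4 * n) * (2 : ℝ) ^ ((d₁ + a / 4) * n)) := by ring
      _ ≤ A * B * (2 : ℝ) ^ ((d + a) * ((n : ℤ) : ℝ)) := by gcongr
      _ ≤ _ := by gcongr; linarith
  · have h := h𝒲.card_le hR0.le hDR hF
    rcases F.eq_empty_or_nonempty with rfl | hFne
    · simp only [Finset.card_empty, Nat.cast_zero]
      positivity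
    have hF1 : (1 : ℝ) ≤ F.card := by exact_mod_cast hFne.card_pos
    have hj' : (j : ℝ) ≤ J := by exact_mod_cast hj.le
    -- Below `-J'` the area bound is less than `1`, so no square is that large.
    have hlow : -(J' : ℝ) ≤ j := by
      by_contra! hcon
      have h3 : (2 : ℝ) ^ (2 * (j : ℝ)) ≤ (2 : ℝ) ^ (-(J' : ℝ)) :=
        Real.rpow_le_rpow_of_exponent_le h2 (by linarith [(J'.cast_nonneg : (0 : ℝ) ≤ J')])
      rw [Real.rpow_neg h2p.le, Real.rpow_natCast] at h3
      have h4 : 4 * R ^ 2 * (2 : ℝ) ^ (2 * (j : ℝ)) < 1 := by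
        calc 4 * R ^ 2 * (2 : ℝ) ^ (2 * (j : ℝ)) ≤ 4 * R ^ 2 * ((2 : ℝ) ^ J')⁻¹ := by gcongr
          _ < (2 : ℝ) ^ J' * ((2 : ℝ) ^ J')⁻¹ := by gcongr
          _ = 1 := mul_inv_cancel₀ (by positivity)
      linarith
    -- With `-J' ≤ j ≤ J`, the excess `(2 - d) j - a j` is at most `2 J + a J'`, uniformly in `d`.
    have hexp : (2 : ℝ) ^ (2 * (j : ℝ)) ≤
        (2 : ℝ) ^ ((2 + a) * (J + J' : ℝ)) * (2 : ℝ) ^ ((d + a) * (j : ℝ)) := by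
      rw [← Real.rpow_add h2p]
      refine Real.rpow_le_rpow_of_exponent_le h2 ?_
      have hJ0 : (0 : ℝ) ≤ J := J.cast_nonneg
      have hJ'0 : (0 : ℝ) ≤ J' := J'.cast_nonneg
      nlinarith [mul_nonneg hd0.le hJ'0, mul_nonneg ha.le hJ0, mul_nonneg ha.le hJ'0,
        mul_nonneg (sub_nonneg.2 hd2.le) (sub_nonneg.2 hj'),
        mul_nonneg hd0.le (sub_nonneg.2 hlow), mul_nonneg ha.le (sub_nonneg.2 hlow),
        mul_nonneg hd0.le hJ0]
    calc (F.card : ℝ) ≤ 4 * R ^ 2 * (2 : ℝ) ^ (2 * (j : ℝ)) := h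
      _ ≤ 4 * R ^ 2 * ((2 : ℝ) ^ ((2 + a) * (J + J' : ℝ)) * (2 : ℝ) ^ ((d + a) * (j : ℝ))) := by
          gcongr
      _ = c₂ * (2 : ℝ) ^ ((d + a) * (j : ℝ)) := by rw [hc₂]; ring
      _ ≤ _ := by gcongr; linarith [mul_pos hA hB]
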